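/- Throughout, "meromorphic" means meromorphic in the whole complex plane. For a meromorphic function $f$ let $T(r,f)=m(r,f)+N(r,f)$ be its Nevanlinna characteristic and $N(r,f)$ its integrated counting function of poles (with multiplicity), and put $$\rho(f)=\limsup_{r\to\infty}\frac{\log^+T(r,f)}{\log r},\qquad \mu(f)=\liminf_{r\to\infty}\frac{\log^+T(r,f)}{\log r},\qquad \lambda\Big(\frac1f\Big)=\limsup_{r\to\infty}\frac{\log^+N(r,f)}{\log r},$$ $$\tau(f)=\limsup_{r\to\infty}\frac{T(r,f)}{r^{\rho(f)}}\ \ (0<\rho(f)<\infty),\qquad \underline{\tau}(f)=\liminf_{r\to\infty}\frac{T(r,f)}{r^{\mu(f)}}\ \ (0<\mu(f)<\infty).$$ **Theorem 1.2.** Let $n,m\ge 0$ be integers, let $A_{ij}$ $(0\le i\le n,\ 0\le j\le m)$ and $F$ be meromorphic functions, and let $c_0,\dots,c_n$ be distinct complex numbers. Let $k,l\in\{0,\dots,n\}$ and $p\in\{0,\dots,m\}$ be integers. Put $$\beta=\max\{\rho(F),\ \rho(A_{ij}) : (i,j)\ne(l,0),(k,p)\},$$ and let $\tau_1$ be the sum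 of the types $\tau(S)$ of those functions $S$ among $F$ and the $A_{ij}$, $(i,j)\neq(l,0),(k,p)$, for which $\rho(S)=\mu(A_{l0})$ (each index pair is counted separately). Assume that 1. $\max\{\mu(A_{kp}),\beta\}\le\mu(A_{l0})<\infty$; 2. $\underline{\tau}(A_{l0})>\underline{\tau}(A_{kp})$ when $\mu(A_{l0})=\mu(A_{kp})$; 3. $\tau_1<\underline{\tau}(A_{l0})<\infty$ when $\mu(A_{l0})=\beta$; 4. $\tau_1+\underline{\tau}(A_{kp})<\underline{\tau}(A_{l0})<\infty$ when $\mu(A_{l0})=\mu(A_{kp})=\beta$; 5. $\lambda\big(\frac1{A_{l0}}\big)<\mu(A_{l0})$. If $F\not\equiv0$, then every meromorphic solution $f$ of $$\sum_{i=0}^n\sum_{j=0}^m A_{ij}(z)f^{(j)}(z+c_i)=F(z)$$ satisfies $\rho(f)\ge\mu(A_{l0})$. If $F\equiv0$, then every meromorphic solution $f\not\equiv0$ of $$\sum_{i=0}^n\sum_{j=0}^m A_{ij}(z)f^{(j)}(z+c_i)=0$$ satisfies $\rho(f)\ge\mu(A_{l0})+1$. -/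

import Mathlib

open Filter Topology

noncomputable section

namespace DiffDiff

/-- The Nevanlinna characteristic `T(r, f) = m(r, f) + N(r, f)` of a meromorphic function on `ℂ`
(with respect to the value `∞`). -/
def T (f : ℂ → ℂ) (r : ℝ) : ℝ := ValueDistribution.characteristic f ⊤ r

/-- The order `ρ(f) = limsup_{r → ∞} log⁺ T(r, f) / log r`, an element of `[0, ∞]`. -/
def order (f : ℂ → ℂ) : ENNReal :=
  limsup (fun r : ℝ => ENNReal.ofReal (Real.posLog (T f r) / Real.log r)) atTop

/-- The lower order `μ(f) = liminf_{r → ∞} log⁺ T(r, f) / log r`, an element of `[0, ∞]`. -/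
def lowerOrder (f : ℂ → ℂ) : ENNReal :=
  liminf (fun r : ℝ => ENNReal.ofReal (Real.posLog (T f r) / Real.log r)) atTop

/-- The type `τ(f) = limsup_{r → ∞} T(r, f) / r ^ ρ(f)`, an element of `[0, ∞]`, of a meromorphic
function of order `0 < ρ(f) < ∞`. -/
def type (f : ℂ → ℂ) : ENNReal :=
  limsup (fun r : ℝ => ENNReal.ofReal (T f r / r ^ (order f).toReal)) atTop

/-- The lower type `liminf_{r → ∞} T(r, f) / r ^ μ(f)`, an element of `[0, ∞]`, of a meromorphic
function of lower order `0 < μ(f) < ∞`. -/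
def lowerType (f : ℂ → ℂ) : ENNReal :=
  liminf (fun r : ℝ => ENNReal.ofReal (T f r / r ^ (lowerOrder f).toReal)) atTop

/-- The exponent of convergence `λ(g) = limsup_{r → ∞} log⁺ N(r, 1/g) / log r` of the sequence of
zeros of `g` (zeros counted with multiplicity), an element of `[0, ∞]`.
Thus `λ(1/f) = limsup log⁺ N(r, f) / log r`, which measures the frequency of the poles of `f`. -/
def convergenceExponent (g : ℂ → ℂ) : ENNReal :=
  limsup (fun r : ℝ =>
    ENNReal.ofReal (Real.posLog (ValueDistribution.logCounting g 0 r) / Real.log r)) atTop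

/-- `f ≡ g` as meromorphic functions: the values agree outside a closed discrete subset of `ℂ`
(the values which Lean assigns at poles are irrelevant). -/
def MeroEq (f g : ℂ → ℂ) : Prop := f =ᶠ[codiscrete ℂ] g

/-- The function `z ↦ ∑ i, ∑ j, A i j z * f⁽ʲ⁾(z + c i)`. -/
def diffDiffOp {n m : ℕ} (A : Fin (n + 1) → Fin (m + 1) → ℂ → ℂ) (c : Fin (n + 1) → ℂ)
    (f : ℂ → ℂ) : ℂ → ℂ :=
  fun z => ∑ i, ∑ j, A i j z * iteratedDeriv (j : ℕ) f (z + c i)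

/-- `f` is a meromorphic solution on `ℂ` of `∑ i, ∑ j, A i j z * f⁽ʲ⁾(z + c i) = F z`. -/
def IsMeroSolution {n m : ℕ} (A : Fin (n + 1) → Fin (m + 1) → ℂ → ℂ) (c : Fin (n + 1) → ℂ)
    (F f : ℂ → ℂ) : Prop :=
  Meromorphic f ∧ MeroEq (diffDiffOp A c f) F

/-- The index pairs `(i, j)` different from `(l, 0)` and from `(k, p)`. -/
def otherIndices {n m : ℕ} (l k : Fin (n + 1)) (p : Fin (m + 1)) :
    Finset (Fin (n + 1) × Fin (m + 1)) :=
  Finset.univ.filter (fun q => q ≠ (l, 0) ∧ q ≠ (k, p))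

/-- `max {ρ(F), ρ(A i j) : (i, j) ≠ (l, 0), (k, p)}`. -/
def maxOrder {n m : ℕ} (A : Fin (n + 1) → Fin (m + 1) → ℂ → ℂ) (F : ℂ → ℂ)
    (l k : Fin (n + 1)) (p : Fin (m + 1)) : ENNReal :=
  max (order F) ((otherIndices l k p).sup (fun q => order (A q.1 q.2)))

open Classical in
/-- The sum `τ₁` of the types of those functions among `F` and `A i j`, `(i, j) ≠ (l, 0), (k, p)`,
whose order is equal to `μ(A l 0)`. -/
def typeSum {n m : ℕ} (A : Fin (n + 1) → Fin (m + 1) → ℂ → ℂ) (F : ℂ → ℂ)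
    (l k : Fin (n + 1)) (p : Fin (m + 1)) : ENNReal :=
  (∑ q ∈ (otherIndices l k p).filter (fun q => order (A q.1 q.2) = lowerOrder (A l 0)),
      type (A q.1 q.2))
    + (if order F = lowerOrder (A l 0) then type F else 0)

end DiffDiff

end

noncomputable section

open Real Metric MeromorphicOn ValueDistribution InnerProductSpace

namespace DiffDiff

/-! ### Circle averages -/

/-! Suppose a solution `f` has too small an order, so that T(r,f) = O(r^t) with t < μ(A_{l0}), or t
< μ(A_{l0}) + 1 when F ≡ 0. Dividing the equation by f(z+c_l) expresses A_{l0} through the other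
coefficients, F/f(z+c_l) and the quotients f^{(j)}(z+c_i)/f(z+c_l). Taking proximity functions and
adding N(r,A_{l0}), which is small by the condition on λ, bounds T(r,A_{l0}) by the sum of the other
characteristics plus an error (`eventually_T_le_of_equation`). If the error is O(r^s) with s <
μ(A_{l0}), this contradicts the comparison of orders and types (`not_eventually_T_le`).

The comparison controls A_{kp} only by a lower limit, hence only on some unbounded set of radii. The
bound must therefore hold for all large r, with no exceptional set. The estimate that gives this is
m(r, f^{(j)}(z+a)/f(z+b)) = O(r^{t-α}) for every 0 < α < 1
(`isBigO_proximity_iteratedDeriv_div_shift`); in the homogeneous case, α close to 1 brings t-α below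
μ(A_{l0}).

To prove it, write log|f| in a disc of radius R as a sum of d(u) log|z-u| over zeros and poles plus
a harmonic function (`exists_log_norm_decomposition`). The Poisson kernel bounds the oscillation of
the harmonic part with a factor 1/R. The logarithms are bounded by multiples of |z-u|^{-α}, whose
mean over |z| = r is O(r^{-α}) uniformly in u (`circleAverage_norm_sub_rpow_le`). Finally R = 4r,
and the number of zeros and poles is bounded through Jensen counting. -/

theorem circleAverage_mono_codiscreteWithin {c : ℂ} {R : ℝ} {f₁ f₂ : ℂ → ℝ} (hR : R ≠ 0)
    (hf₁ : CircleIntegrable f₁ c R) (hf₂ : CircleIntegrable f₂ c R)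
    (h : ∀ᶠ x in codiscreteWithin (sphere c |R|), f₁ x ≤ f₂ x) :
    circleAverage f₁ c R ≤ circleAverage f₂ c R := by
  have h' : f₁ =ᶠ[codiscreteWithin (sphere c |R|)] fun x => min (f₁ x) (f₂ x) := by
    filter_upwards [h] with x hx using (min_eq_left hx).symm
  rw [circleAverage_congr_codiscreteWithin h' hR]
  exact circleAverage_mono (hf₁.congr_codiscreteWithin h') hf₂ fun x _ => min_le_right _ _

/-- On [0, π/2] Jordan's inequality sin t ≥ 2t/π reduces the claim to t^{-α}; reflection t ↦ π - t
and π-periodicity do the rest. -/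
theorem intervalIntegrable_abs_sin_rpow {α : ℝ} (h0 : 0 ≤ α) (h1 : α < 1) (a b : ℝ) :
    IntervalIntegrable (fun t : ℝ => |sin t| ^ (-α)) MeasureTheory.volume a b := by
  have hmeas : Measurable fun t : ℝ => |sin t| ^ (-α) := by fun_prop
  have key : IntervalIntegrable (fun t : ℝ => |sin t| ^ (-α)) MeasureTheory.volume 0 (π / 2) := by
    have hi : IntervalIntegrable (fun t : ℝ => (2 / π) ^ (-α) * t ^ (-α)) MeasureTheory.volume
        0 (π / 2) := (intervalIntegral.intervalIntegrable_rpow' (by linarith)).const_mul _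
    refine hi.mono_fun hmeas.aestronglyMeasurable ?_
    refine (MeasureTheory.ae_restrict_iff' measurableSet_uIoc).2 (Eventually.of_forall ?_)
    intro t ht
    rw [Set.uIoc_of_le (by positivity)] at ht
    have h3 := mul_le_sin ht.1.le ht.2
    have h4 : 0 < 2 / π * t := mul_pos (by positivity) ht.1
    simp only
    rw [abs_of_pos (h4.trans_le h3), norm_of_nonneg (rpow_nonneg (h4.trans_le h3).le _),
      norm_of_nonneg (mul_nonneg (by positivity) (rpow_nonneg ht.1.le _)),
      ← mul_rpow (by positivity) ht.1.le]
    exact rpow_le_rpow_of_nonpos h4 h3 (by linarith)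
  have key2 : IntervalIntegrable (fun t : ℝ => |sin t| ^ (-α)) MeasureTheory.volume 0 π := by
    refine key.trans ?_
    have := (key.comp_sub_left π).symm
    simp only [sin_pi_sub] at this
    convert this using 1 <;> ring
  have hper : Function.Periodic (fun t : ℝ => |sin t| ^ (-α)) π := fun t => by
    simp [sin_add_pi]
  exact hper.intervalIntegrable₀ pi_pos.ne' key2 a b

/-- The mean of `|sin| ^ (-α)` over a period. -/
def sinMean (α : ℝ) : ℝ := (2 * π)⁻¹ * ∫ t in (0 : ℝ)..2 * π, |sin t| ^ (-α)

/-- Rotate `a` onto the nonnegative real axis: the distance is at least the imaginary part, which no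
longer involves |a|. This is the source of uniformity in `a`. -/
theorem mul_abs_sin_le_norm_circleMap_sub (a : ℂ) {r : ℝ} (hr : 0 < r) (θ : ℝ) :
    r * |sin (θ - a.arg)| ≤ ‖circleMap 0 r θ - a‖ := by
  have h1 : ‖circleMap 0 r θ - a‖
      = ‖(circleMap 0 r θ - a) * Complex.exp (-(a.arg : ℂ) * Complex.I)‖ := by
    rw [norm_mul, ← Complex.ofReal_neg, Complex.norm_exp_ofReal_mul_I, mul_one]
  have h2 : (circleMap 0 r θ - a) * Complex.exp (-(a.arg : ℂ) * Complex.I)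
      = r * Complex.exp (((θ - a.arg : ℝ) : ℂ) * Complex.I) - ‖a‖ := by
    rw [sub_mul]
    congr 1
    · rw [circleMap_zero, mul_assoc, ← Complex.exp_add]
      push_cast
      ring_nf
    · conv_lhs => rw [← Complex.norm_mul_exp_arg_mul_I a]
      rw [mul_assoc, ← Complex.exp_add]
      simp
  rw [h1, h2]
  refine le_trans (le_of_eq ?_) (Complex.abs_im_le_norm _)
  rw [Complex.exp_mul_I, ← Complex.ofReal_sin, ← Complex.ofReal_cos]
  simp [-Complex.ofReal_sin, -Complex.ofReal_cos, abs_mul, abs_of_pos hr]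

theorem norm_circleMap_sub_rpow_le {α : ℝ} (h0 : 0 ≤ α) (a : ℂ) {r : ℝ}
    (hr : 0 < r) {θ : ℝ} (hθ : sin (θ - a.arg) ≠ 0) :
    ‖circleMap 0 r θ - a‖ ^ (-α) ≤ r ^ (-α) * |sin (θ - a.arg)| ^ (-α) := by
  rw [← mul_rpow hr.le (abs_nonneg _)]
  exact rpow_le_rpow_of_nonpos (mul_pos hr (abs_pos.2 hθ))
    (mul_abs_sin_le_norm_circleMap_sub a hr θ) (by linarith)

theorem ae_sin_sub_ne_zero (a : ℝ) : ∀ᵐ θ : ℝ, sin (θ - a) ≠ 0 := by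
  have hc : Set.Countable {θ : ℝ | sin (θ - a) = 0} := by
    refine (Set.countable_range fun n : ℤ => (n : ℝ) * π + a).mono fun θ hθ => ?_
    obtain ⟨n, hn⟩ := sin_eq_zero_iff.1 hθ
    exact ⟨n, by simp [hn]⟩
  exact hc.ae_notMem _

theorem intervalIntegrable_abs_sin_sub_rpow {α : ℝ} (h0 : 0 ≤ α) (h1 : α < 1) (φ : ℝ) :
    IntervalIntegrable (fun t : ℝ => |sin (t - φ)| ^ (-α)) MeasureTheory.volume 0 (2 * π) := by
  have := (intervalIntegrable_abs_sin_rpow h0 h1 (0 - φ) (2 * π - φ)).comp_sub_right φ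
  simpa using this

theorem circleIntegrable_norm_sub_rpow {α : ℝ} (h0 : 0 ≤ α) (h1 : α < 1) (a : ℂ) {r : ℝ}
    (hr : 0 < r) : CircleIntegrable (fun z => ‖z - a‖ ^ (-α)) 0 r := by
  have hi := (intervalIntegrable_abs_sin_sub_rpow h0 h1 a.arg).const_mul (r ^ (-α))
  refine hi.mono_fun (Measurable.aestronglyMeasurable ?_) ?_
  · have : Measurable (circleMap 0 r) := (continuous_circleMap 0 r).measurable
    fun_prop
  · filter_upwards [MeasureTheory.ae_restrict_of_ae (ae_sin_sub_ne_zero a.arg)] with θ hθ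
    rw [norm_of_nonneg (by positivity), norm_of_nonneg (by positivity)]
    exact norm_circleMap_sub_rpow_le h0 a hr hθ

theorem circleAverage_norm_sub_rpow_le {α : ℝ} (h0 : 0 ≤ α) (h1 : α < 1) (a : ℂ) {r : ℝ}
    (hr : 0 < r) : circleAverage (fun z => ‖z - a‖ ^ (-α)) 0 r ≤ sinMean α * r ^ (-α) := by
  have hper : Function.Periodic (fun t : ℝ => |sin t| ^ (-α)) (2 * π) := fun t => by simp
  have hint : ∫ t in (0 : ℝ)..2 * π, |sin (t - a.arg)| ^ (-α)
      = ∫ t in (0 : ℝ)..2 * π, |sin t| ^ (-α) := by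
    rw [intervalIntegral.integral_comp_sub_right (fun t => |sin t| ^ (-α)) a.arg]
    have := hper.intervalIntegral_add_eq (0 - a.arg) 0
    rw [zero_add] at this
    rw [← this]
    congr 1
    ring
  rw [circleAverage, sinMean, smul_eq_mul, mul_assoc]
  refine mul_le_mul_of_nonneg_left ?_ (by positivity)
  rw [← hint, mul_comm _ (r ^ (-α)), ← intervalIntegral.integral_const_mul]
  refine intervalIntegral.integral_mono_ae (by positivity)
    (circleIntegrable_norm_sub_rpow h0 h1 a hr)
    ((intervalIntegrable_abs_sin_sub_rpow h0 h1 a.arg).const_mul (r ^ (-α))) ?_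
  filter_upwards [ae_sin_sub_ne_zero a.arg] with θ hθ
  exact norm_circleMap_sub_rpow_le h0 a hr hθ

/-! ### Harmonic functions -/

/-- The Herglotz kernels differ by 2ζ(w-z)/((ζ-w)(ζ-z)), and both factors of the denominator are at
least R/2 in modulus. -/
theorem abs_poissonKernel_sub_le {R : ℝ} (hR : 0 < R) {z w ζ : ℂ} (hz : ‖z‖ ≤ R / 2)
    (hw : ‖w‖ ≤ R / 2) (hζ : ‖ζ‖ = R) :
    |poissonKernel 0 w ζ - poissonKernel 0 z ζ| ≤ 8 * ‖w - z‖ / R := by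
  have hzζ : R / 2 ≤ ‖ζ - z‖ := by linarith [norm_sub_norm_le ζ z]
  have hwζ : R / 2 ≤ ‖ζ - w‖ := by linarith [norm_sub_norm_le ζ w]
  have hz0 : ζ - z ≠ 0 := norm_pos_iff.1 (by linarith)
  have hw0 : ζ - w ≠ 0 := norm_pos_iff.1 (by linarith)
  rw [poissonKernel_eq_re_herglotzRieszKernel, poissonKernel_eq_re_herglotzRieszKernel,
    Function.comp_apply, Function.comp_apply, ← Complex.sub_re]
  refine (Complex.abs_re_le_norm _).trans ?_
  have : herglotzRieszKernel 0 w ζ - herglotzRieszKernel 0 z ζ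
      = 2 * ζ * (w - z) / ((ζ - w) * (ζ - z)) := by
    simp only [herglotzRieszKernel_def, sub_zero]
    field_simp
    ring
  rw [this, norm_div, norm_mul, norm_mul, norm_mul, hζ, Complex.norm_ofNat]
  calc 2 * R * ‖w - z‖ / (‖ζ - w‖ * ‖ζ - z‖)
      ≤ 2 * R * ‖w - z‖ / (R / 2 * (R / 2)) := by gcongr
    _ = 8 * ‖w - z‖ / R := by field_simp; ring

theorem _root_.InnerProductSpace.HarmonicOnNhd.abs_sub_le {u : ℂ → ℝ} {R : ℝ} (hR : 0 < R)
    (hu : HarmonicOnNhd u (closedBall 0 R)) {z w : ℂ} (hz : ‖z‖ ≤ R / 2) (hw : ‖w‖ ≤ R / 2) :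
    |u w - u z| ≤ 8 * ‖w - z‖ / R * circleAverage (fun ζ => |u ζ|) 0 R := by
  have hcont : ContinuousOn u (sphere 0 |R|) := fun x hx =>
    (HarmonicAt.analyticAt (hu x (sphere_subset_closedBall
      (abs_of_pos hR ▸ hx)))).continuousAt.continuousWithinAt
  have hzb : z ∈ ball (0 : ℂ) R := by simpa using by linarith
  have hwb : w ∈ ball (0 : ℂ) R := by simpa using by linarith
  have hker : ∀ x ∈ ball (0 : ℂ) R, CircleIntegrable (poissonKernel 0 x • u) 0 R := by
    intro x hx
    refine ContinuousOn.circleIntegrable' (ContinuousOn.smul ?_ hcont)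
    rw [poissonKernel_eq_re_herglotzRieszKernel]
    exact Complex.continuous_re.comp_continuousOn (continuousOn_herglotzRieszKernel_sphere hx)
  rw [← hu.circleAverage_poissonKernel_smul hwb, ← hu.circleAverage_poissonKernel_smul hzb,
    ← circleAverage_sub (hker w hwb) (hker z hzb)]
  refine abs_circleAverage_le_circleAverage_abs.trans ?_
  rw [← smul_eq_mul, ← circleAverage_fun_smul]
  refine circleAverage_mono ((hker w hwb).sub (hker z hzb)).abs ?_ ?_
  · exact (hcont.abs.const_smul (8 * ‖w - z‖ / R)).circleIntegrable'
  · intro ζ hζ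
    rw [abs_of_pos hR, mem_sphere_zero_iff_norm] at hζ
    change |poissonKernel 0 w ζ * u ζ - poissonKernel 0 z ζ * u ζ| ≤ 8 * ‖w - z‖ / R * |u ζ|
    rw [← sub_mul, abs_mul]
    exact mul_le_mul_of_nonneg_right (abs_poissonKernel_sub_le hR hz hw hζ) (abs_nonneg _)

/-- A point at which `log ‖f‖` is Lipschitz with constant `L` satisfies `‖f' / f‖ ≤ L`. -/
theorem norm_deriv_div_le_of_abs_log_norm_sub_le {f : ℂ → ℂ} {z : ℂ} {L : ℝ}
    (hf : DifferentiableAt ℂ f z) (hz : f z ≠ 0)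
    (hL : ∀ᶠ w in 𝓝 z, |log ‖f w‖ - log ‖f z‖| ≤ L * ‖w - z‖) :
    ‖deriv f z / f z‖ ≤ L := by
  set d := deriv f z / f z with hd
  have hL0 : 0 ≤ L := by
    by_contra hneg
    push Not at hneg
    have h1 : ∀ᶠ w in 𝓝[≠] z, |log ‖f w‖ - log ‖f z‖| ≤ L * ‖w - z‖ :=
      hL.filter_mono nhdsWithin_le_nhds
    obtain ⟨w, hw, hwz⟩ := (h1.and self_mem_nhdsWithin).exists
    have : 0 < ‖w - z‖ := norm_pos_iff.2 (sub_ne_zero.2 hwz)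
    nlinarith [abs_nonneg (log ‖f w‖ - log ‖f z‖)]
  rcases eq_or_ne d 0 with h0 | h0
  · simpa [h0] using hL0
  -- The unit direction of steepest growth of log|f|: along it the derivative is exactly ‖d‖.
  set v : ℂ := (starRingEnd ℂ) d / ‖d‖ with hv
  have hvn : ‖v‖ = 1 := by simp [hv, h0]
  have hdv : d * v = ‖d‖ := by
    rw [hv, mul_div_assoc', Complex.mul_conj, Complex.normSq_eq_norm_sq]
    have : (‖d‖ : ℂ) ≠ 0 := by simpa using h0
    push_cast
    field_simp
  have hline : HasDerivAt (fun t : ℝ => z + (t : ℂ) * v) v 0 := by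
    have := ((Complex.ofRealCLM.hasDerivAt (x := (0 : ℝ))).mul_const v).const_add z
    simpa using this
  have h1 : HasDerivAt (fun t : ℝ => f (z + (t : ℂ) * v) / f z) (‖d‖ : ℂ) 0 := by
    have h2 : HasDerivAt f (deriv f z) (z + ((0 : ℝ) : ℂ) * v) := by simpa using hf.hasDerivAt
    have := (h2.comp (0 : ℝ) hline).div_const (f z)
    have h3 : deriv f z * v / f z = (‖d‖ : ℂ) := by rw [← hdv, hd]; ring
    rwa [h3] at this
  have h3 : HasDerivAt (fun t : ℝ => Complex.log (f (z + (t : ℂ) * v) / f z)) (‖d‖ : ℂ) 0 := by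
    have h4 := h1.clog_real (by simp [hz])
    simpa [hz] using h4
  have h5 : HasDerivAt (fun t : ℝ => log ‖f (z + (t : ℂ) * v) / f z‖) ‖d‖ 0 := by
    have := (Complex.reCLM.hasFDerivAt.comp_hasDerivAt (0 : ℝ) h3)
    simpa [Function.comp_def, Complex.log_re] using this
  have hcont : Tendsto (fun t : ℝ => z + (t : ℂ) * v) (𝓝[>] 0) (𝓝 z) := by
    have := hline.continuousAt.tendsto
    simp only [Complex.ofReal_zero, zero_mul, add_zero] at this
    exact this.mono_left nhdsWithin_le_nhds
  have hne : ∀ᶠ w in 𝓝 z, f w ≠ 0 := hf.continuousAt.eventually_ne hz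
  have h6 := (hasDerivAt_iff_tendsto_slope_zero.1 h5).mono_left
    (nhdsWithin_mono 0 (show Set.Ioi (0 : ℝ) ⊆ {0}ᶜ from fun x hx => (ne_of_gt hx : x ≠ 0)))
  refine le_of_tendsto h6 ?_
  filter_upwards [hcont.eventually hL, hcont.eventually hne, self_mem_nhdsWithin] with t h7 h8 ht
  have ht : 0 < t := ht
  have h9 : ‖z + (t : ℂ) * v - z‖ = t := by simp [hvn, abs_of_pos ht]
  rw [h9] at h7
  simp only [zero_add, Complex.ofReal_zero, zero_mul, add_zero, div_self hz, norm_one, log_one,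
    sub_zero, smul_eq_mul]
  rw [norm_div, log_div (norm_ne_zero_iff.2 h8) (norm_ne_zero_iff.2 hz), inv_mul_le_iff₀ ht,
    mul_comm t L]
  exact (le_abs_self _).trans h7

end DiffDiff

end

noncomputable section

open Real Metric MeromorphicOn ValueDistribution InnerProductSpace

namespace DiffDiff

/-! ### Codiscrete filters -/

theorem eventually_codiscrete_iff {P : ℂ → Prop} :
    (∀ᶠ z in codiscrete ℂ, P z) ↔ ∀ x, ∀ᶠ y in 𝓝[≠] x, P y := by
  rw [Filter.Eventually, mem_codiscrete]
  simp [disjoint_principal_right, Filter.Eventually]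

theorem eventually_codiscrete_comp_add {P : ℂ → Prop} (h : ∀ᶠ z in codiscrete ℂ, P z) (a : ℂ) :
    ∀ᶠ z in codiscrete ℂ, P (z + a) := by
  rw [eventually_codiscrete_iff] at h ⊢
  intro x
  have : Tendsto (fun y => y + a) (𝓝[≠] x) (𝓝[≠] (x + a)) := by
    refine tendsto_nhdsWithin_iff.2 ⟨?_, ?_⟩
    · exact ((continuous_id.add continuous_const).tendsto x).mono_left nhdsWithin_le_nhds
    · filter_upwards [self_mem_nhdsWithin] with y hy
      simpa using hy
  exact this.eventually (h (x + a))

/-- A punctured neighbourhood is a neighbourhood of each of its points. This allows identities valid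
off a discrete set to be differentiated. -/
theorem eventually_codiscrete_eventually_nhds {P : ℂ → Prop} (h : ∀ᶠ z in codiscrete ℂ, P z) :
    ∀ᶠ z in codiscrete ℂ, ∀ᶠ w in 𝓝 z, P w := by
  have h' := h
  rw [eventually_codiscrete_iff] at h ⊢
  intro x
  have h1 := h x
  filter_upwards [eventually_eventually_nhdsWithin.2 h1, h1, self_mem_nhdsWithin] with y hy hy' hyx
  rw [IsOpen.nhdsWithin_eq isOpen_compl_singleton hyx] at hy
  exact hy

theorem eventually_codiscrete_of_closedBall {P : ℂ → Prop} {R : ℝ}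
    (h : ∀ᶠ z in codiscreteWithin (closedBall (0 : ℂ) R), P z) :
    ∀ᶠ z in codiscrete ℂ, ‖z‖ ≤ R → P z := by
  rw [eventually_codiscrete_iff]
  intro x
  by_cases hx : x ∈ closedBall (0 : ℂ) R
  · have h1 := mem_codiscreteWithin.1 h x hx
    rw [disjoint_principal_right] at h1
    filter_upwards [h1] with y hy hyR
    by_contra hP
    exact hy ⟨by simpa using hyR, hP⟩
  · refine Eventually.filter_mono nhdsWithin_le_nhds ?_
    filter_upwards [isClosed_closedBall.isOpen_compl.mem_nhds hx] with y hy hyR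
    exact absurd (by simpa using hyR) hy

theorem eventually_codiscrete_ne (u : ℂ) : ∀ᶠ z in codiscrete ℂ, z ≠ u := by
  rw [eventually_codiscrete_iff]
  intro x
  rcases eq_or_ne x u with rfl | hx
  · exact self_mem_nhdsWithin
  · exact (eventually_ne_nhds hx).filter_mono nhdsWithin_le_nhds

theorem eventually_codiscrete_notMem (S : Finset ℂ) : ∀ᶠ z in codiscrete ℂ, z ∉ S := by
  have : ∀ᶠ z in codiscrete ℂ, ∀ u ∈ S, z ≠ u :=
    (eventually_all_finset S).2 fun u _ => eventually_codiscrete_ne u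
  filter_upwards [this] with z hz hzS using hz z hzS rfl

theorem _root_.Meromorphic.eventually_codiscrete_ne_zero {f : ℂ → ℂ} (hf : Meromorphic f)
    (h : ∀ z, meromorphicOrderAt f z ≠ ⊤) : ∀ᶠ z in codiscrete ℂ, f z ≠ 0 := by
  rw [eventually_codiscrete_iff]
  exact fun x => (meromorphicOrderAt_ne_top_iff_eventually_ne_zero (hf x)).1 (h x)

theorem _root_.Meromorphic.meromorphicOrderAt_ne_top_of_not_meroEq {f : ℂ → ℂ} (hf : Meromorphic f)
    (h : ¬ MeroEq f 0) (z : ℂ) : meromorphicOrderAt f z ≠ ⊤ := by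
  by_contra hz
  apply h
  rw [MeroEq, EventuallyEq, eventually_codiscrete_iff]
  intro x
  rw [Pi.zero_def, ← meromorphicOrderAt_eq_top_iff]
  by_contra hx
  exact hf.exists_meromorphicOrderAt_ne_top_iff_forall.1 ⟨x, hx⟩ z hz

theorem codiscrete_le_sphere (r : ℝ) : codiscreteWithin (sphere (0 : ℂ) r) ≤ codiscrete ℂ :=
  codiscreteWithin_mono (Set.subset_univ _)

/-! ### Zeros and poles in a disc -/

/-- The number of zeros and poles, with multiplicity, in the closed disc of radius `R`. -/
def zeroPoleCount (f : ℂ → ℂ) (R : ℝ) : ℝ :=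
  ∑ᶠ u, |(divisor f (closedBall 0 R) u : ℝ)|

theorem zeroPoleCount_nonneg (f : ℂ → ℂ) (R : ℝ) : 0 ≤ zeroPoleCount f R :=
  finsum_nonneg fun _ => abs_nonneg _

/-- After the finitely many zeros and poles in the disc are divided out, an analytic zero-free
factor g remains, and log|g| is harmonic. -/
theorem exists_log_norm_eq_sum_add_harmonic {f : ℂ → ℂ} (hf : Meromorphic f)
    (h0 : ∀ z, meromorphicOrderAt f z ≠ ⊤) (R : ℝ) :
    ∃ (S : Finset ℂ) (d : ℂ → ℤ) (h : ℂ → ℝ), (∀ u ∈ S, u ∈ closedBall (0 : ℂ) R) ∧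
      ∑ u ∈ S, |(d u : ℝ)| = zeroPoleCount f R ∧ HarmonicOnNhd h (closedBall 0 R) ∧
      ∀ᶠ z in codiscreteWithin (closedBall (0 : ℂ) R),
        log ‖f z‖ = ∑ u ∈ S, (d u : ℝ) * log ‖z - u‖ + h z := by
  set D := divisor f (closedBall (0 : ℂ) R) with hD
  have hfin : D.support.Finite := D.finiteSupport (isCompact_closedBall 0 R)
  obtain ⟨g, hg, hg0, hfg⟩ := (hf.meromorphicOn (s := closedBall 0 R)).extract_zeros_poles
    (fun u => h0 u) hfin
  refine ⟨hfin.toFinset, D, fun z => log ‖g z‖, ?_, ?_, ?_, ?_⟩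
  · intro u hu
    exact D.supportWithinDomain (hfin.mem_toFinset.1 hu)
  · refine (finsum_eq_sum_of_support_subset _ ?_).symm
    intro u hu
    simpa using hu
  · exact fun z hz => (hg z hz).harmonicAt_log_norm (hg0 ⟨z, hz⟩)
  · have h1 := extract_zeros_poles_log hg0 hfg
    filter_upwards [h1] with z hz
    rw [hz, Pi.add_apply]
    congr 1
    rw [finsum_eq_sum_of_support_subset (s := hfin.toFinset)]
    · simp [hD]
    · intro u hu
      simp only [Set.Finite.coe_toFinset, Function.mem_support] at hu ⊢
      rintro h
      apply hu
      ext
      simp [hD] at h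
      simp [h]

/-- With y = log|z-u| - log R, the bound y ≤ log 2 gives |y| ≤ 2 log 2 - y, and y has mean zero by
Jensen's formula. -/
theorem circleAverage_abs_log_norm_sub_le {R : ℝ} (hR : 1 ≤ R) {u : ℂ}
    (hu : u ∈ closedBall (0 : ℂ) R) :
    circleAverage (fun z => |log ‖z - u‖ - log R|) 0 R ≤ 2 * log 2 := by
  have hR0 : 0 < R := by linarith
  have hi : CircleIntegrable (fun z => log ‖z - u‖) 0 R :=
    MeromorphicOn.circleIntegrable_log_norm (fun _ _ => by fun_prop)
  have hi2 : CircleIntegrable (fun z => log ‖z - u‖ - log R) 0 R :=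
    hi.sub (circleIntegrable_const _ _ _)
  have key : circleAverage (fun z => |log ‖z - u‖ - log R|) 0 R
      ≤ circleAverage (fun z => 2 * log 2 - (log ‖z - u‖ - log R)) 0 R := by
    refine circleAverage_mono hi2.abs ((circleIntegrable_const _ _ _).sub hi2) fun z hz => ?_
    rw [abs_of_pos hR0, mem_sphere_zero_iff_norm] at hz
    have hy : log ‖z - u‖ - log R ≤ log 2 := by
      rcases eq_or_ne (z - u) 0 with h | h
      -- At z = u the convention log 0 = 0 makes y = -log R, which is where R ≥ 1 is needed.
      · simp only [h, norm_zero, log_zero]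
        linarith [log_nonneg hR, log_nonneg one_le_two]
      · rw [sub_le_iff_le_add, ← log_mul two_ne_zero hR0.ne']
        refine log_le_log (norm_pos_iff.2 h) ((norm_sub_le _ _).trans ?_)
        have : ‖u‖ ≤ R := by simpa using hu
        linarith
    rcases abs_cases (log ‖z - u‖ - log R) with h | h <;> linarith [log_nonneg one_le_two]
  refine key.trans (le_of_eq ?_)
  have e1 := circleAverage_sub (circleIntegrable_const (2 * log 2) (0 : ℂ) R) hi2
  have e2 := circleAverage_sub hi (circleIntegrable_const (log R) (0 : ℂ) R)
  have e3 := circleAverage_log_norm_sub_const_of_mem_closedBall (c := 0) (R := R) (a := u)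
    (by rwa [abs_of_pos hR0])
  simp only [circleAverage_const, Pi.sub_def] at e1 e2
  rw [e1, e2, e3]
  ring

/-- The quantity controlling the oscillation of the zero-free part of `log ‖f‖` in a disc. -/
def oscBound (f : ℂ → ℂ) (R : ℝ) : ℝ :=
  proximity f ⊤ R + proximity f⁻¹ ⊤ R + 2 * log 2 * zeroPoleCount f R

theorem oscBound_nonneg (f : ℂ → ℂ) (R : ℝ) : 0 ≤ oscBound f R := by
  have h1 : 0 ≤ proximity f ⊤ R := proximity_nonneg R
  have h2 : 0 ≤ proximity f⁻¹ ⊤ R := proximity_nonneg R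
  have h3 := zeroPoleCount_nonneg f R
  have h4 := log_nonneg one_le_two
  unfold oscBound
  positivity

theorem circleAverage_abs_log_norm {f : ℂ → ℂ} (hf : Meromorphic f) (R : ℝ) :
    circleAverage (fun z => |log ‖f z‖|) 0 R = proximity f ⊤ R + proximity f⁻¹ ⊤ R := by
  rw [proximity_top, proximity_top, ← circleAverage_add
    hf.meromorphicOn.circleIntegrable_posLog_norm
    hf.inv.meromorphicOn.circleIntegrable_posLog_norm]
  congr 1
  ext z
  simp only [Pi.add_apply, Pi.inv_apply, norm_inv, posLog, log_inv]
  rcases abs_cases (log ‖f z‖) with h | h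
  · rw [h.1, max_eq_right h.2, max_eq_left (by linarith), add_zero]
  · rw [h.1, max_eq_left h.2.le, max_eq_right (by linarith), zero_add]

theorem exists_log_norm_decomposition {f : ℂ → ℂ} (hf : Meromorphic f)
    (h0 : ∀ z, meromorphicOrderAt f z ≠ ⊤) {R : ℝ} (hR : 1 ≤ R) :
    ∃ (S : Finset ℂ) (d : ℂ → ℤ) (h : ℂ → ℝ),
      ∑ u ∈ S, |(d u : ℝ)| = zeroPoleCount f R ∧
      (∀ z w : ℂ, ‖z‖ ≤ R / 2 → ‖w‖ ≤ R / 2 → |h w - h z| ≤ 8 * ‖w - z‖ / R * oscBound f R) ∧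
      ∀ᶠ z in codiscrete ℂ, ‖z‖ ≤ R → log ‖f z‖ = ∑ u ∈ S, (d u : ℝ) * log ‖z - u‖ + h z := by
  have hR0 : 0 < R := by linarith
  obtain ⟨S, d, h, hS, hd, hh, hfh⟩ := exists_log_norm_eq_sum_add_harmonic hf h0 R
  refine ⟨S, d, h, hd, ?_, eventually_codiscrete_of_closedBall hfh⟩
  -- Adding this constant replaces each log|z-u| by log|z-u| - log R, whose mean absolute value is
  -- bounded independently of R; differences of `h` are unchanged.
  set M := ∑ u ∈ S, (d u : ℝ) * log R with hM
  have hh' : HarmonicOnNhd (fun z => h z + M) (closedBall 0 R) :=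
    fun z hz => (hh z hz).add (harmonicAt_const M)
  have hcont : ContinuousOn (fun z => h z + M) (sphere 0 |R|) := fun x hx =>
    (HarmonicAt.analyticAt (hh' x (sphere_subset_closedBall
      (abs_of_pos hR0 ▸ hx)))).continuousAt.continuousWithinAt
  have hterm : ∀ u, CircleIntegrable (fun z => |(d u : ℝ)| * |log ‖z - u‖ - log R|) 0 R := by
    intro u
    have h1 : CircleIntegrable (fun z => log ‖z - u‖) 0 R :=
      MeromorphicOn.circleIntegrable_log_norm (fun _ _ => by fun_prop)
    exact (h1.sub (circleIntegrable_const _ _ _)).abs.const_mul _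
  have hlogf : CircleIntegrable (fun z => |log ‖f z‖|) 0 R :=
    (MeromorphicOn.circleIntegrable_log_norm hf.meromorphicOn).abs
  have hsum : CircleIntegrable (fun z => ∑ u ∈ S, |(d u : ℝ)| * |log ‖z - u‖ - log R|) 0 R :=
    CircleIntegrable.fun_sum S fun u _ => hterm u
  have havg : circleAverage (fun z => |h z + M|) 0 R ≤ oscBound f R := by
    have h1 : circleAverage (fun z => |h z + M|) 0 R ≤ circleAverage
        (fun z => |log ‖f z‖| + ∑ u ∈ S, |(d u : ℝ)| * |log ‖z - u‖ - log R|) 0 R := by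
      refine circleAverage_mono_codiscreteWithin hR0.ne' hcont.circleIntegrable'.abs
        (hlogf.add hsum) ?_
      have hle : codiscreteWithin (sphere (0 : ℂ) |R|) ≤ codiscreteWithin (closedBall 0 R) := by
        rw [abs_of_pos hR0]
        exact codiscreteWithin_mono sphere_subset_closedBall
      filter_upwards [hfh.filter_mono hle] with z hz
      have e1 : h z + M = log ‖f z‖ - ∑ u ∈ S, (d u : ℝ) * (log ‖z - u‖ - log R) := by
        rw [hz, hM]
        simp only [mul_sub, Finset.sum_sub_distrib]
        ring
      rw [e1]
      refine (abs_sub _ _).trans (add_le_add le_rfl ((Finset.abs_sum_le_sum_abs _ _).trans ?_))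
      simp [abs_mul]
    refine h1.trans ?_
    have e2 := circleAverage_add hlogf hsum
    rw [Pi.add_def] at e2
    rw [e2, circleAverage_abs_log_norm hf, circleAverage_fun_sum fun u _ => hterm u, oscBound,
      ← hd, Finset.mul_sum]
    gcongr with u hu
    have e3 := circleAverage_fun_smul (a := |(d u : ℝ)|) (f := fun z => |log ‖z - u‖ - log R|)
      (c := 0) (R := R)
    simp only [smul_eq_mul] at e3
    rw [e3, mul_comm]
    gcongr
    exact circleAverage_abs_log_norm_sub_le hR (hS u hu)
  intro z w hz hw
  have h2 := hh'.abs_sub_le hR0 hz hw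
  rw [add_sub_add_right_eq_sub] at h2
  exact h2.trans (by gcongr)

end DiffDiff

end

noncomputable section

open Real Metric MeromorphicOn ValueDistribution InnerProductSpace

namespace DiffDiff

/-! ### Elementary inequalities -/

/-- α log(1+x) = log (1+x)^α ≤ log(1+x^α) ≤ x^α, by subadditivity of the power. -/
theorem log_one_add_le_rpow_div {α x : ℝ} (h0 : 0 < α) (h1 : α ≤ 1) (hx : 0 ≤ x) :
    log (1 + x) ≤ x ^ α / α := by
  rw [le_div_iff₀ h0, mul_comm, ← log_rpow (by linarith)]
  have h2 : (1 + x) ^ α ≤ 1 + x ^ α := by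
    simpa using rpow_add_le_add_rpow (p := α) zero_le_one hx h0.le h1
  have h3 : 0 < (1 + x) ^ α := rpow_pos_of_pos (by linarith) _
  linarith [log_le_sub_one_of_pos h3]

theorem log_div_le_rpow {α : ℝ} (h0 : 0 < α) (h1 : α ≤ 1) {x y : ℂ} (hx : x ≠ 0) (hy : y ≠ 0) :
    log ‖x‖ - log ‖y‖ ≤ ‖x - y‖ ^ α / α * ‖y‖ ^ (-α) := by
  have hy' : 0 < ‖y‖ := norm_pos_iff.2 hy
  rw [← log_div (norm_ne_zero_iff.2 hx) hy'.ne']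
  have h2 : ‖x‖ / ‖y‖ ≤ 1 + ‖x - y‖ / ‖y‖ := by
    rw [div_le_iff₀ hy', add_mul, div_mul_cancel₀ _ hy'.ne']
    linarith [norm_le_norm_add_norm_sub' x y]
  calc log (‖x‖ / ‖y‖) ≤ log (1 + ‖x - y‖ / ‖y‖) :=
        log_le_log (div_pos (norm_pos_iff.2 hx) hy') h2
    _ ≤ (‖x - y‖ / ‖y‖) ^ α / α := log_one_add_le_rpow_div h0 h1 (by positivity)
    _ = ‖x - y‖ ^ α / α * ‖y‖ ^ (-α) := by
        rw [div_rpow (norm_nonneg _) hy'.le, rpow_neg hy'.le]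
        ring

theorem abs_log_norm_sub_log_norm_le {α : ℝ} (h0 : 0 < α) (h1 : α ≤ 1) {x y : ℂ} (hx : x ≠ 0)
    (hy : y ≠ 0) :
    |log ‖x‖ - log ‖y‖| ≤ ‖x - y‖ ^ α / α * (‖x‖ ^ (-α) + ‖y‖ ^ (-α)) := by
  have h2 := log_div_le_rpow h0 h1 hx hy
  have h3 := log_div_le_rpow h0 h1 hy hx
  rw [norm_sub_rev] at h3
  have h4 : 0 ≤ ‖x - y‖ ^ α / α * ‖x‖ ^ (-α) := by positivity
  have h5 : 0 ≤ ‖x - y‖ ^ α / α * ‖y‖ ^ (-α) := by positivity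
  rw [mul_add, abs_le]
  constructor <;> linarith

theorem posLog_le_rpow_div {α x : ℝ} (h0 : 0 < α) (hx : 0 ≤ x) : log⁺ x ≤ x ^ α / α :=
  max_le (by positivity) (log_le_rpow_div hx h0)

theorem sum_rpow_le_rpow_sum {ι : Type*} (s : Finset ι) (x : ι → ℝ) (hx : ∀ i ∈ s, 0 ≤ x i) {α : ℝ}
    (h0 : 0 < α) (h1 : α ≤ 1) : (∑ i ∈ s, x i) ^ α ≤ ∑ i ∈ s, x i ^ α := by
  classical
  induction s using Finset.induction with
  | empty => simp [h0.ne']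
  | insert a s ha ih =>
    rw [Finset.sum_insert ha, Finset.sum_insert ha]
    refine (rpow_add_le_add_rpow (hx a (by simp)) (Finset.sum_nonneg fun i hi =>
      hx i (by simp [hi])) h0.le h1).trans ?_
    gcongr
    exact ih fun i hi => hx i (by simp [hi])

/-- Integrality matters: |d| is 0 or at least 1. So multiplicities raised to the power α still add
up to at most `zeroPoleCount`. -/
theorem abs_intCast_rpow_le {α : ℝ} (h0 : 0 < α) (h1 : α ≤ 1) (d : ℤ) :
    |(d : ℝ)| ^ α ≤ |(d : ℝ)| := by
  rcases eq_or_ne d 0 with rfl | hd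
  · simp [h0.ne']
  · have : (1 : ℝ) ≤ |(d : ℝ)| := by exact_mod_cast Int.one_le_abs hd
    simpa using rpow_le_rpow_of_exponent_le this h1

/-! ### Differences and derivatives of `log ‖f‖` -/

theorem eventually_posLog_norm_div_shift_le {f : ℂ → ℂ} (hf : Meromorphic f)
    (h0 : ∀ z, meromorphicOrderAt f z ≠ ⊤) {R : ℝ} (hR : 1 ≤ R) {α : ℝ} (hα0 : 0 < α)
    (hα1 : α ≤ 1) (a b : ℂ) :
    ∃ (S : Finset ℂ) (d : ℂ → ℝ), (∀ u, 0 ≤ d u) ∧ ∑ u ∈ S, d u = zeroPoleCount f R ∧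
      ∀ᶠ z in codiscrete ℂ, ‖z + a‖ ≤ R / 2 → ‖z + b‖ ≤ R / 2 →
        log⁺ ‖f (z + a) / f (z + b)‖ ≤ 8 * ‖a - b‖ / R * oscBound f R +
          ∑ u ∈ S, d u * (‖a - b‖ ^ α / α * (‖z - (u - a)‖ ^ (-α) + ‖z - (u - b)‖ ^ (-α))) := by
  obtain ⟨S, d, h, hd, hh, hfh⟩ := exists_log_norm_decomposition hf h0 hR
  refine ⟨S, fun u => |(d u : ℝ)|, fun u => abs_nonneg _, hd, ?_⟩
  filter_upwards [eventually_codiscrete_comp_add hfh a, eventually_codiscrete_comp_add hfh b,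
    eventually_codiscrete_comp_add (hf.eventually_codiscrete_ne_zero h0) a,
    eventually_codiscrete_comp_add (hf.eventually_codiscrete_ne_zero h0) b,
    eventually_codiscrete_comp_add (eventually_codiscrete_notMem S) a,
    eventually_codiscrete_comp_add (eventually_codiscrete_notMem S) b]
    with z ha hb ha0 hb0 haS hbS hza hzb
  have hosc := oscBound_nonneg f R
  refine max_le ?_ ?_
  · have : 0 ≤ R := by linarith
    positivity
  rw [norm_div, log_div (norm_ne_zero_iff.2 ha0) (norm_ne_zero_iff.2 hb0), ha (by linarith),
    hb (by linarith)]
  have e : ∑ u ∈ S, (d u : ℝ) * log ‖z + a - u‖ + h (z + a)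
        - (∑ u ∈ S, (d u : ℝ) * log ‖z + b - u‖ + h (z + b))
      = (h (z + a) - h (z + b))
        + ∑ u ∈ S, (d u : ℝ) * (log ‖z + a - u‖ - log ‖z + b - u‖) := by
    simp only [mul_sub, Finset.sum_sub_distrib]
    ring
  rw [e]
  refine add_le_add ?_ (Finset.sum_le_sum fun u hu => ?_)
  · have := hh (z + b) (z + a) hzb hza
    rw [add_sub_add_left_eq_sub] at this
    exact (le_abs_self _).trans this
  · have hxa : z + a - u ≠ 0 := fun h' => haS (by rwa [sub_eq_zero.1 h'])
    have hxb : z + b - u ≠ 0 := fun h' => hbS (by rwa [sub_eq_zero.1 h'])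
    refine (le_abs_self _).trans ?_
    rw [abs_mul]
    gcongr
    have := abs_log_norm_sub_log_norm_le hα0 hα1 hxa hxb
    rw [sub_sub_sub_cancel_right, add_sub_add_left_eq_sub] at this
    rwa [sub_sub_eq_add_sub, sub_sub_eq_add_sub]

/-- The right-hand side is a local Lipschitz constant of log|f|: the harmonic part contributes the
first term, each zero or pole a slope 2/|z-u|. -/
theorem eventually_norm_deriv_div_le {f : ℂ → ℂ} (hf : Meromorphic f)
    (h0 : ∀ z, meromorphicOrderAt f z ≠ ⊤) {R : ℝ} (hR : 1 ≤ R) :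
    ∃ (S : Finset ℂ) (d : ℂ → ℤ), ∑ u ∈ S, |(d u : ℝ)| = zeroPoleCount f R ∧
      ∀ᶠ z in codiscrete ℂ, ‖z‖ < R / 2 →
        ‖deriv f z / f z‖ ≤ 8 / R * oscBound f R + ∑ u ∈ S, |(d u : ℝ)| * (2 * ‖z - u‖⁻¹) := by
  obtain ⟨S, d, h, hd, hh, hfh⟩ := exists_log_norm_decomposition hf h0 hR
  refine ⟨S, d, hd, ?_⟩
  have han : ∀ᶠ z in codiscrete ℂ, AnalyticAt ℂ f z := by
    rw [eventually_codiscrete_iff]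
    exact fun x => (hf x).eventually_analyticAt
  filter_upwards [eventually_codiscrete_eventually_nhds hfh, hf.eventually_codiscrete_ne_zero h0,
    eventually_codiscrete_notMem S, han] with z hz hz0 hzS hzan hzR
  refine norm_deriv_div_le_of_abs_log_norm_sub_le hzan.differentiableAt hz0 ?_
  have hball : ∀ᶠ w in 𝓝 z, ‖w‖ < R / 2 := (continuous_norm.tendsto z).eventually_lt_const hzR
  -- Keeps |w-u| ≥ |z-u|/2, which accounts for the factor 2 in the slope.
  have hclose : ∀ᶠ w in 𝓝 z, ∀ u ∈ S, ‖w - z‖ < ‖z - u‖ / 2 := by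
    rw [eventually_all_finset]
    intro u hu
    have : 0 < ‖z - u‖ / 2 :=
      half_pos (norm_pos_iff.2 (sub_ne_zero.2 fun h' => hzS (h' ▸ hu)))
    have ht : Tendsto (fun w => ‖w - z‖) (𝓝 z) (𝓝 0) := by
      have := ((continuous_id.sub continuous_const).norm : Continuous fun w => ‖w - z‖).tendsto z
      simpa using this
    exact ht.eventually_lt_const this
  filter_upwards [hz, hball, hclose] with w hw hwR hwS
  rw [hw (by linarith), hz.self_of_nhds (by linarith)]
  have e : ∑ u ∈ S, (d u : ℝ) * log ‖w - u‖ + h w - (∑ u ∈ S, (d u : ℝ) * log ‖z - u‖ + h z)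
      = (h w - h z) + ∑ u ∈ S, (d u : ℝ) * (log ‖w - u‖ - log ‖z - u‖) := by
    simp only [mul_sub, Finset.sum_sub_distrib]
    ring
  rw [e, add_mul, Finset.sum_mul]
  refine (abs_add_le _ _).trans (add_le_add ?_ ((Finset.abs_sum_le_sum_abs _ _).trans
    (Finset.sum_le_sum fun u hu => ?_)))
  · refine (hh z w hzR.le hwR.le).trans (le_of_eq ?_)
    ring
  · rw [abs_mul, mul_assoc]
    gcongr
    have hzu : 0 < ‖z - u‖ := norm_pos_iff.2 (sub_ne_zero.2 fun h' => hzS (h' ▸ hu))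
    have h3 : ‖z - u‖ / 2 ≤ ‖w - u‖ := by
      have := hwS u hu
      have h4 := norm_sub_le_norm_add (z - u) (w - z)
      have h5 : ‖z - u‖ ≤ ‖w - u‖ + ‖w - z‖ := by
        have := norm_sub_le (w - u) (w - z)
        rwa [sub_sub_sub_cancel_left] at this
      linarith
    have hwu : 0 < ‖w - u‖ := by linarith
    have key : ∀ x y : ℂ, x ≠ 0 → y ≠ 0 → ‖z - u‖ / 2 ≤ ‖y‖ →
        log ‖x‖ - log ‖y‖ ≤ 2 * ‖z - u‖⁻¹ * ‖x - y‖ := by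
      intro x y hx hy hyz
      have h6 := log_div_le_rpow one_pos le_rfl hx hy
      rw [rpow_one, rpow_neg_one, div_one] at h6
      refine h6.trans ?_
      rw [mul_comm]
      gcongr
      rw [← div_eq_mul_inv, le_div_iff₀ hzu, inv_mul_le_iff₀ (norm_pos_iff.2 hy)]
      linarith
    have k1 := key (w - u) (z - u) (norm_pos_iff.1 hwu) (norm_pos_iff.1 hzu) (by linarith)
    have k2 := key (z - u) (w - u) (norm_pos_iff.1 hzu) (norm_pos_iff.1 hwu) h3
    rw [sub_sub_sub_cancel_right] at k1 k2
    rw [norm_sub_rev z w] at k2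
    rw [abs_le]
    constructor <;> linarith

/-- The singularity |z-u|^{-1} is not integrable along a circle through u. Using log⁺ x ≤ x^α/α and
subadditivity of the α-th power turns it into the integrable |z-u|^{-α}. -/
theorem eventually_posLog_norm_deriv_div_shift_le {f : ℂ → ℂ} (hf : Meromorphic f)
    (h0 : ∀ z, meromorphicOrderAt f z ≠ ⊤) {R : ℝ} (hR : 1 ≤ R) {α : ℝ} (hα0 : 0 < α)
    (hα1 : α ≤ 1) (a : ℂ) :
    ∃ (S : Finset ℂ) (d : ℂ → ℝ), (∀ u, 0 ≤ d u) ∧ ∑ u ∈ S, d u = zeroPoleCount f R ∧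
      ∀ᶠ z in codiscrete ℂ, ‖z + a‖ < R / 2 →
        log⁺ ‖deriv f (z + a) / f (z + a)‖ ≤ (8 / R * oscBound f R) ^ α / α +
          ∑ u ∈ S, d u * (2 / α * ‖z - (u - a)‖ ^ (-α)) := by
  obtain ⟨S, d, hd, hfh⟩ := eventually_norm_deriv_div_le hf h0 hR
  refine ⟨S, fun u => |(d u : ℝ)|, fun u => abs_nonneg _, hd, ?_⟩
  filter_upwards [eventually_codiscrete_comp_add hfh a] with z hz hzR
  have hosc := oscBound_nonneg f R
  have hR0 : 0 < R := by linarith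
  refine (posLog_le_rpow_div hα0 (norm_nonneg _)).trans ?_
  have h1 : ‖deriv f (z + a) / f (z + a)‖ ^ α ≤ (8 / R * oscBound f R) ^ α +
      ∑ u ∈ S, |(d u : ℝ)| * (2 * ‖z - (u - a)‖ ^ (-α)) := by
    refine (rpow_le_rpow (norm_nonneg _) (hz hzR) hα0.le).trans ?_
    refine (rpow_add_le_add_rpow (by positivity) (Finset.sum_nonneg fun u _ => by positivity)
      hα0.le hα1).trans (add_le_add le_rfl ?_)
    refine (sum_rpow_le_rpow_sum S _ (fun u _ => by positivity) hα0 hα1).trans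
      (Finset.sum_le_sum fun u _ => ?_)
    rw [mul_rpow (abs_nonneg _) (by positivity), mul_rpow zero_le_two (by positivity),
      inv_rpow (norm_nonneg _), ← rpow_neg (norm_nonneg _), ← sub_sub_eq_add_sub]
    have h2 : (2 : ℝ) ^ α ≤ 2 := by
      simpa using rpow_le_rpow_of_exponent_le one_le_two hα1
    have h3 := abs_intCast_rpow_le hα0 hα1 (d u)
    gcongr
  calc ‖deriv f (z + a) / f (z + a)‖ ^ α / α ≤ ((8 / R * oscBound f R) ^ α +
      ∑ u ∈ S, |(d u : ℝ)| * (2 * ‖z - (u - a)‖ ^ (-α))) / α := by gcongr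
    _ = _ := by
      rw [add_div, Finset.sum_div]
      congr 1
      exact Finset.sum_congr rfl fun u _ => by ring

/-! ### Proximity functions of difference quotients and logarithmic derivatives -/

theorem circleAverage_sum_mul_norm_sub_rpow_le {α : ℝ} (h0 : 0 < α) (h1 : α < 1) (S : Finset ℂ)
    (d : ℂ → ℝ) (hd : ∀ u, 0 ≤ d u) (C : ℝ) (hC : 0 ≤ C) (p : ℂ → ℂ) {r : ℝ} (hr : 0 < r) :
    circleAverage (fun z => ∑ u ∈ S, d u * (C * ‖z - p u‖ ^ (-α))) 0 r
      ≤ (∑ u ∈ S, d u) * (C * (sinMean α * r ^ (-α))) := by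
  have hi : ∀ u, CircleIntegrable (fun z => d u * (C * ‖z - p u‖ ^ (-α))) 0 r := fun u =>
    ((circleIntegrable_norm_sub_rpow h0.le h1 (p u) hr).const_mul C).const_mul (d u)
  rw [circleAverage_fun_sum fun u _ => hi u, Finset.sum_mul]
  refine Finset.sum_le_sum fun u _ => ?_
  have e := circleAverage_fun_smul (a := d u * C) (f := fun z => ‖z - p u‖ ^ (-α)) (c := 0) (R := r)
  simp only [smul_eq_mul] at e
  simp only [← mul_assoc] at e ⊢
  rw [e, mul_assoc (d u * C)]
  gcongr
  · exact mul_nonneg (hd u) hC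
  · exact circleAverage_norm_sub_rpow_le h0.le h1 (p u) hr

theorem circleIntegrable_sum_mul_norm_sub_rpow {α : ℝ} (h0 : 0 < α) (h1 : α < 1) (S : Finset ℂ)
    (d : ℂ → ℝ) (C : ℝ) (p : ℂ → ℂ) {r : ℝ} (hr : 0 < r) :
    CircleIntegrable (fun z => ∑ u ∈ S, d u * (C * ‖z - p u‖ ^ (-α))) 0 r :=
  CircleIntegrable.fun_sum S fun u _ =>
    ((circleIntegrable_norm_sub_rpow h0.le h1 (p u) hr).const_mul C).const_mul (d u)

theorem norm_add_le_of_mem_sphere {r R : ℝ} (hr : 0 < r) {a z : ℂ}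
    (hz : z ∈ sphere (0 : ℂ) |r|) (h : r + ‖a‖ < R) : ‖z + a‖ < R := by
  rw [abs_of_pos hr, mem_sphere_zero_iff_norm] at hz
  linarith [norm_add_le z a]

theorem proximity_div_shift_le {f : ℂ → ℂ} (hf : Meromorphic f)
    (h0 : ∀ z, meromorphicOrderAt f z ≠ ⊤) {r R : ℝ} (hr : 0 < r) (hR : 1 ≤ R) {α : ℝ}
    (hα0 : 0 < α) (hα1 : α < 1) {a b : ℂ} (ha : r + ‖a‖ < R / 2) (hb : r + ‖b‖ < R / 2) :
    proximity (fun z => f (z + a) / f (z + b)) ⊤ r ≤ 8 * ‖a - b‖ / R * oscBound f R +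
      2 * (zeroPoleCount f R * (‖a - b‖ ^ α / α * (sinMean α * r ^ (-α)))) := by
  obtain ⟨S, d, hd0, hd, h⟩ := eventually_posLog_norm_div_shift_le hf h0 hR hα0 hα1.le a b
  have hm : Meromorphic fun z => f (z + a) / f (z + b) :=
    (Meromorphic.meromorphic_fun_comp_add_const_iff_meromorphic.2 hf).div
      (Meromorphic.meromorphic_fun_comp_add_const_iff_meromorphic.2 hf)
  set C := ‖a - b‖ ^ α / α
  have hC : 0 ≤ C := by positivity
  set K := 8 * ‖a - b‖ / R * oscBound f R
  have hi1 := circleIntegrable_sum_mul_norm_sub_rpow hα0 hα1 S d C (fun u => u - a) hr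
  have hi2 := circleIntegrable_sum_mul_norm_sub_rpow hα0 hα1 S d C (fun u => u - b) hr
  have hb1 := circleAverage_sum_mul_norm_sub_rpow_le hα0 hα1 S d hd0 C hC (fun u => u - a) hr
  have hb2 := circleAverage_sum_mul_norm_sub_rpow_le hα0 hα1 S d hd0 C hC (fun u => u - b) hr
  rw [hd] at hb1 hb2
  rw [proximity_top]
  have key := circleAverage_mono_codiscreteWithin hr.ne'
    (hm.meromorphicOn.circleIntegrable_posLog_norm)
    (((circleIntegrable_const K (0 : ℂ) r).add hi1).add hi2) ?_
  · refine key.trans ?_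
    rw [circleAverage_add ((circleIntegrable_const K (0 : ℂ) r).add hi1) hi2,
      circleAverage_add (circleIntegrable_const K (0 : ℂ) r) hi1, circleAverage_const]
    linarith
  · filter_upwards [h.filter_mono (codiscrete_le_sphere |r|), self_mem_codiscreteWithin _]
      with z hz hzr
    refine (hz (norm_add_le_of_mem_sphere hr hzr ha).le
      (norm_add_le_of_mem_sphere hr hzr hb).le).trans (le_of_eq ?_)
    simp only [Pi.add_apply, mul_add, Finset.sum_add_distrib]
    ring

theorem proximity_deriv_div_shift_le {f : ℂ → ℂ} (hf : Meromorphic f)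
    (h0 : ∀ z, meromorphicOrderAt f z ≠ ⊤) {r R : ℝ} (hr : 0 < r) (hR : 1 ≤ R) {α : ℝ}
    (hα0 : 0 < α) (hα1 : α < 1) {a : ℂ} (ha : r + ‖a‖ < R / 2) :
    proximity (fun z => deriv f (z + a) / f (z + a)) ⊤ r ≤ (8 / R * oscBound f R) ^ α / α +
      zeroPoleCount f R * (2 / α * (sinMean α * r ^ (-α))) := by
  obtain ⟨S, d, hd0, hd, h⟩ := eventually_posLog_norm_deriv_div_shift_le hf h0 hR hα0 hα1.le a
  have hm : Meromorphic fun z => deriv f (z + a) / f (z + a) :=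
    (Meromorphic.meromorphic_fun_comp_add_const_iff_meromorphic.2 hf.deriv).div
      (Meromorphic.meromorphic_fun_comp_add_const_iff_meromorphic.2 hf)
  set C := 2 / α
  have hC : 0 ≤ C := by positivity
  set K := (8 / R * oscBound f R) ^ α / α
  have hi1 := circleIntegrable_sum_mul_norm_sub_rpow hα0 hα1 S d C (fun u => u - a) hr
  have hb1 := circleAverage_sum_mul_norm_sub_rpow_le hα0 hα1 S d hd0 C hC (fun u => u - a) hr
  rw [hd] at hb1
  rw [proximity_top]
  have key := circleAverage_mono_codiscreteWithin hr.ne'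
    (hm.meromorphicOn.circleIntegrable_posLog_norm)
    ((circleIntegrable_const K (0 : ℂ) r).add hi1) ?_
  · refine key.trans ?_
    rw [circleAverage_add (circleIntegrable_const K (0 : ℂ) r) hi1, circleAverage_const]
    linarith
  · filter_upwards [h.filter_mono (codiscrete_le_sphere |r|), self_mem_codiscreteWithin _]
      with z hz hzr
    exact hz (norm_add_le_of_mem_sphere hr hzr ha)

end DiffDiff

end

noncomputable section

open Real Metric MeromorphicOn ValueDistribution InnerProductSpace Asymptotics

namespace DiffDiff

/-! ### Counting zeros and poles by the characteristic -/

open Function.locallyFinsuppWithin in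
-- A point with 0 < |u| ≤ R has weight log(2R/|u|) ≥ log 2 in the counting function at 2R; the
-- origin has weight log(2R) ≥ log 2.
theorem log_two_mul_finsum_le_logCounting {E : Function.locallyFinsupp ℂ ℤ} (hE : 0 ≤ E) {R : ℝ}
    (hR : 1 ≤ R) :
    log 2 * ∑ᶠ u, (toClosedBall R E u : ℝ) ≤ Function.locallyFinsuppWithin.logCounting E (2 * R) := by
  classical
  have hR0 : 0 < R := by linarith
  -- The origin is adjoined so that its separate term in the counting function can be absorbed into
  -- the sum over `s`.
  set s : Finset ℂ := insert 0 ((toClosedBall (2 * R) E).finiteSupport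
    (isCompact_closedBall 0 |2 * R|)).toFinset with hs
  have hmem : ∀ u, E u ≠ 0 → ‖u‖ ≤ 2 * R → u ∈ s := by
    intro u hu hur
    have : u ∈ closedBall (0 : ℂ) |2 * R| := by simpa [abs_of_pos hR0] using hur
    simp only [hs, Finset.mem_insert, Set.Finite.mem_toFinset, Function.mem_support]
    right
    rwa [toClosedBall_eval_within _ this]
  have hsup : ∀ ρ, 0 ≤ ρ → ρ ≤ 2 * R → ∀ u, toClosedBall ρ E u ≠ 0 → u ∈ s := by
    intro ρ hρ hρR u hu
    have h1 : u ∈ closedBall (0 : ℂ) |ρ| := toClosedBall_support_subset_closedBall E hu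
    rw [toClosedBall_eval_within _ h1] at hu
    exact hmem u hu (by simpa [abs_of_nonneg hρ] using h1 |> fun h => (by
      have := mem_closedBall_zero_iff.1 h1; rw [abs_of_nonneg hρ] at this; linarith : ‖u‖ ≤ 2 * R))
  rw [finsum_eq_sum_of_support_subset (s := s) _ (by
    intro u hu
    exact hsup R hR0.le (by linarith) u (by simpa using hu))]
  simp only [Function.locallyFinsuppWithin.logCounting, AddMonoidHom.coe_mk, ZeroHom.coe_mk]
  rw [finsum_eq_sum_of_support_subset (s := s) _ (by
    intro u hu
    exact hsup (2 * R) (by linarith) le_rfl u (by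
      intro h
      simp [h] at hu))]
  have h0s : (0 : ℂ) ∈ s := by simp [hs]
  have e1 : (E 0 : ℝ) * log (2 * R) = ∑ u ∈ s, if u = 0 then (E 0 : ℝ) * log (2 * R) else 0 := by
    simp [h0s]
  rw [e1, ← Finset.sum_add_distrib, Finset.mul_sum]
  refine Finset.sum_le_sum fun u _ => ?_
  have hEu : (0 : ℝ) ≤ E u := by exact_mod_cast hE u
  have hlog2 := log_nonneg one_le_two
  rcases eq_or_ne u 0 with rfl | hu
  · rw [toClosedBall_eval_within _ (by simp)]
    -- Since 0⁻¹ = 0 and log 0 = 0, the generic summand vanishes here and only the separate term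
    -- E(0) log(2R) counts.
    simp only [norm_zero, inv_zero, mul_zero, log_zero, if_true, zero_add]
    rw [mul_comm]
    gcongr
    linarith
  · rw [if_neg hu, add_zero]
    have hu' : 0 < ‖u‖ := norm_pos_iff.2 hu
    by_cases h1 : u ∈ closedBall (0 : ℂ) |R|
    · have h3 : ‖u‖ ≤ R := by simpa [abs_of_pos hR0] using h1
      have h2 : u ∈ closedBall (0 : ℂ) |2 * R| := by
        rw [mem_closedBall_zero_iff, abs_of_pos (by linarith)]
        linarith
      rw [toClosedBall_eval_within _ h1, toClosedBall_eval_within _ h2, mul_comm]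
      gcongr
      rw [← div_eq_mul_inv, le_div_iff₀ hu']
      linarith
    · rw [Function.locallyFinsuppWithin.apply_eq_zero_of_notMem _ h1, Int.cast_zero, mul_zero]
      by_cases h2 : u ∈ closedBall (0 : ℂ) |2 * R|
      · rw [toClosedBall_eval_within _ h2]
        refine mul_nonneg hEu (log_nonneg ?_)
        rw [mem_closedBall_zero_iff, abs_of_pos (by linarith)] at h2
        rw [← div_eq_mul_inv, one_le_div hu']
        exact h2
      · rw [Function.locallyFinsuppWithin.apply_eq_zero_of_notMem _ h2]
        simp

theorem log_two_mul_zeroPoleCount_le {f : ℂ → ℂ} (hf : Meromorphic f) {R : ℝ} (hR : 1 ≤ R) :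
    log 2 * zeroPoleCount f R ≤ ValueDistribution.logCounting f ⊤ (2 * R) +
      ValueDistribution.logCounting f⁻¹ ⊤ (2 * R) := by
  set D := divisor f Set.univ
  have h1 := log_two_mul_finsum_le_logCounting (E := D⁻ + D⁺)
    (add_nonneg (negPart_nonneg D) (posPart_nonneg D)) hR
  rw [Function.locallyFinsuppWithin.logCounting.map_add, Pi.add_apply] at h1
  rw [logCounting_inv, logCounting_top, logCounting_zero]
  refine le_trans (le_of_eq ?_) h1
  congr 1
  refine finsum_congr fun u => ?_
  have e : closedBall (0 : ℂ) R = closedBall 0 |R| := by rw [abs_of_pos (by linarith)]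
  rw [e, Function.locallyFinsuppWithin.toClosedBall_divisor hf]
  by_cases hu : u ∈ closedBall (0 : ℂ) |R|
  · rw [Function.locallyFinsuppWithin.toClosedBall_eval_within _ hu,
      Function.locallyFinsuppWithin.toClosedBall_eval_within _ hu]
    have : (D⁻ + D⁺) u = |D u| := by
      rw [Function.locallyFinsuppWithin.coe_add, Pi.add_apply, ← posPart_add_negPart (D u), add_comm]
      rfl
    rw [this]
    push_cast
    rfl
  · rw [Function.locallyFinsuppWithin.apply_eq_zero_of_notMem _ hu,
      Function.locallyFinsuppWithin.apply_eq_zero_of_notMem _ hu]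
    simp

theorem proximity_le_T (f : ℂ → ℂ) {r : ℝ} (hr : 1 ≤ r) : proximity f ⊤ r ≤ T f r := by
  have : 0 ≤ ValueDistribution.logCounting f ⊤ r := logCounting_nonneg hr
  simp only [T, characteristic, Pi.add_apply]
  linarith

theorem logCounting_le_T (f : ℂ → ℂ) (r : ℝ) : ValueDistribution.logCounting f ⊤ r ≤ T f r := by
  have : 0 ≤ proximity f ⊤ r := proximity_nonneg r
  simp only [T, characteristic, Pi.add_apply]
  linarith

/-! ### Growth of order `r ^ t` -/

theorem isBigO_rpow_comp_mul {g : ℝ → ℝ} {t c : ℝ} (hc : 0 < c)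
    (hg : g =O[atTop] fun r : ℝ => r ^ t) : (fun r => g (c * r)) =O[atTop] fun r : ℝ => r ^ t := by
  have h1 := hg.comp_tendsto (tendsto_id.const_mul_atTop hc)
  refine h1.trans (IsBigO.of_bound (c ^ t) ?_)
  filter_upwards [eventually_ge_atTop 0] with r hr
  simp only [Function.comp_apply, id_eq]
  rw [mul_rpow hc.le hr, norm_mul, norm_of_nonneg (rpow_nonneg hc.le t)]

theorem isBigO_rpow_rpow {s t : ℝ} (h : s ≤ t) :
    (fun r : ℝ => r ^ s) =O[atTop] fun r : ℝ => r ^ t := by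
  refine IsBigO.of_bound 1 ?_
  filter_upwards [eventually_ge_atTop 1] with r hr
  rw [norm_of_nonneg (by positivity), norm_of_nonneg (by positivity), one_mul]
  exact rpow_le_rpow_of_exponent_le hr h

theorem isBigO_const_rpow (c : ℝ) {t : ℝ} (ht : 0 ≤ t) :
    (fun _ : ℝ => c) =O[atTop] fun r : ℝ => r ^ t := by
  have h1 : (fun _ : ℝ => c) =O[atTop] fun r : ℝ => r ^ (0 : ℝ) := by
    simpa using isBigO_const_const c (one_ne_zero (α := ℝ)) atTop
  exact h1.trans (isBigO_rpow_rpow ht)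

theorem isBigO_of_eventually_nonneg_le {g h k : ℝ → ℝ} (h0 : ∀ᶠ r in atTop, 0 ≤ g r)
    (h1 : ∀ᶠ r in atTop, g r ≤ h r) (hh : h =O[atTop] k) : g =O[atTop] k := by
  refine IsBigO.trans (IsBigO.of_bound 1 ?_) hh
  filter_upwards [h0, h1] with r h2 h3
  rw [one_mul, norm_of_nonneg h2]
  exact h3.trans (le_norm_self _)

variable {f : ℂ → ℂ} {t : ℝ}

theorem isBigO_T_inv (hf : Meromorphic f) (ht : 0 ≤ t) (hT : T f =O[atTop] fun r : ℝ => r ^ t) :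
    T f⁻¹ =O[atTop] fun r : ℝ => r ^ t := by
  have h1 := isBigO_characteristic_sub_characteristic_inv hf
  have h2 : (1 : ℝ → ℝ) =O[atTop] fun r : ℝ => r ^ t := isBigO_const_rpow 1 ht
  have h3 := hT.sub (h1.trans h2)
  refine h3.congr_left fun r => ?_
  simp [T]

theorem isBigO_proximity (hT : T f =O[atTop] fun r : ℝ => r ^ t) :
    proximity f ⊤ =O[atTop] fun r : ℝ => r ^ t := by
  refine isBigO_of_eventually_nonneg_le (.of_forall fun r => proximity_nonneg r) ?_ hT
  filter_upwards [eventually_ge_atTop 1] with r hr using proximity_le_T f hr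

theorem isBigO_zeroPoleCount (hf : Meromorphic f) (ht : 0 ≤ t)
    (hT : T f =O[atTop] fun r : ℝ => r ^ t) :
    zeroPoleCount f =O[atTop] fun r : ℝ => r ^ t := by
  have h1 := (isBigO_rpow_comp_mul two_pos hT).add
    (isBigO_rpow_comp_mul two_pos (isBigO_T_inv hf ht hT))
  have h2 := h1.const_mul_left (log 2)⁻¹
  refine isBigO_of_eventually_nonneg_le (.of_forall fun r => zeroPoleCount_nonneg f r) ?_ h2
  filter_upwards [eventually_ge_atTop 1] with R hR
  rw [le_inv_mul_iff₀ (log_pos one_lt_two)]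
  exact (log_two_mul_zeroPoleCount_le hf hR).trans
    (add_le_add (logCounting_le_T _ _) (logCounting_le_T _ _))

theorem isBigO_oscBound (hf : Meromorphic f) (ht : 0 ≤ t)
    (hT : T f =O[atTop] fun r : ℝ => r ^ t) :
    oscBound f =O[atTop] fun r : ℝ => r ^ t :=
  ((isBigO_proximity hT).add (isBigO_proximity (isBigO_T_inv hf ht hT))).add
    ((isBigO_zeroPoleCount hf ht hT).const_mul_left (2 * log 2))

theorem isBigO_rpow_mul {g h : ℝ → ℝ} {s u : ℝ} (hg : g =O[atTop] fun r : ℝ => r ^ s)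
    (hh : h =O[atTop] fun r : ℝ => r ^ u) :
    (fun r => g r * h r) =O[atTop] fun r : ℝ => r ^ (s + u) := by
  refine (hg.mul hh).trans (IsBigO.of_bound 1 ?_)
  filter_upwards [eventually_gt_atTop 0] with r hr
  rw [rpow_add hr, one_mul]

/-- The disc radius is R = 4r, so that r + |a| < R/2 as soon as r > |a|. The factor 1/R in the
oscillation estimate gains a full power of r. -/
theorem isBigO_inv_mul_oscBound (hf : Meromorphic f) (ht : 0 ≤ t)
    (hT : T f =O[atTop] fun r : ℝ => r ^ t) (c : ℝ) :
    (fun r => c / (4 * r) * oscBound f (4 * r)) =O[atTop] fun r : ℝ => r ^ (t - 1) := by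
  have h1 := isBigO_rpow_comp_mul four_pos (isBigO_oscBound hf ht hT)
  have h2 : (fun r : ℝ => c / (4 * r)) =O[atTop] fun r : ℝ => r ^ (-1 : ℝ) := by
    refine IsBigO.of_bound (‖c / 4‖) ?_
    filter_upwards [eventually_gt_atTop 0] with r hr
    rw [rpow_neg_one, ← norm_mul]
    refine le_of_eq (congrArg _ ?_)
    field_simp
  have := isBigO_rpow_mul h2 h1
  rwa [neg_add_eq_sub] at this

theorem isBigO_zeroPoleCount_mul (hf : Meromorphic f) (ht : 0 ≤ t)
    (hT : T f =O[atTop] fun r : ℝ => r ^ t) (c α : ℝ) :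
    (fun r => zeroPoleCount f (4 * r) * (c * r ^ (-α))) =O[atTop] fun r : ℝ => r ^ (t - α) := by
  have h1 := isBigO_rpow_comp_mul four_pos (isBigO_zeroPoleCount hf ht hT)
  have h2 : (fun r : ℝ => c * r ^ (-α)) =O[atTop] fun r : ℝ => r ^ (-α) :=
    (isBigO_refl _ _).const_mul_left c
  exact isBigO_rpow_mul h1 h2

theorem isBigO_proximity_div_shift (hf : Meromorphic f) (h0 : ∀ z, meromorphicOrderAt f z ≠ ⊤)
    (ht : 0 ≤ t) (hT : T f =O[atTop] fun r : ℝ => r ^ t) {α : ℝ} (hα0 : 0 < α) (hα1 : α < 1)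
    (a b : ℂ) :
    proximity (fun z => f (z + a) / f (z + b)) ⊤ =O[atTop] fun r : ℝ => r ^ (t - α) := by
  have h1 := (isBigO_inv_mul_oscBound hf ht hT (8 * ‖a - b‖)).trans
    (isBigO_rpow_rpow (by linarith : t - 1 ≤ t - α))
  have h2 := (isBigO_zeroPoleCount_mul hf ht hT (‖a - b‖ ^ α / α * sinMean α) α).const_mul_left 2
  refine isBigO_of_eventually_nonneg_le (.of_forall fun r => proximity_nonneg r) ?_ (h1.add h2)
  filter_upwards [eventually_ge_atTop 1, eventually_gt_atTop ‖a‖, eventually_gt_atTop ‖b‖]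
    with r hr hra hrb
  refine (proximity_div_shift_le hf h0 (by linarith) (by linarith : 1 ≤ 4 * r) hα0 hα1
    (by linarith) (by linarith)).trans (le_of_eq ?_)
  ring

theorem isBigO_proximity_deriv_div_shift (hf : Meromorphic f)
    (h0 : ∀ z, meromorphicOrderAt f z ≠ ⊤) (ht : 0 ≤ t) (hT : T f =O[atTop] fun r : ℝ => r ^ t)
    {α : ℝ} (hα0 : 0 < α) (hα1 : α < 1) (a : ℂ) :
    proximity (fun z => deriv f (z + a) / f (z + a)) ⊤ =O[atTop] fun r : ℝ => r ^ (t - α) := by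
  have h1 : (fun r => (8 / (4 * r) * oscBound f (4 * r)) ^ α / α)
      =O[atTop] fun r : ℝ => r ^ (t - α) := by
    have h3 := (isBigO_inv_mul_oscBound hf ht hT 8).rpow hα0.le (by
      filter_upwards [eventually_gt_atTop 0] with r hr using by simpa using rpow_nonneg hr.le _)
    have h4 : (fun r : ℝ => (r ^ (t - 1)) ^ α) =O[atTop] fun r : ℝ => r ^ (t - α) := by
      refine IsBigO.trans (IsBigO.of_bound 1 ?_) (isBigO_rpow_rpow (s := (t - 1) * α) ?_)
      · filter_upwards [eventually_ge_atTop 0] with r hr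
        rw [one_mul, rpow_mul hr]
      -- This is (t-1)α ≤ t-α, that is tα ≤ t, which uses t ≥ 0.
      · nlinarith
    simpa only [div_eq_inv_mul _ α] using (h3.trans h4).const_mul_left α⁻¹
  have h2 := isBigO_zeroPoleCount_mul hf ht hT (2 / α * sinMean α) α
  refine isBigO_of_eventually_nonneg_le (.of_forall fun r => proximity_nonneg r) ?_ (h1.add h2)
  filter_upwards [eventually_ge_atTop 1, eventually_gt_atTop ‖a‖] with r hr hra
  refine (proximity_deriv_div_shift_le hf h0 (by linarith) (by linarith : 1 ≤ 4 * r) hα0 hα1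
    (by linarith)).trans (le_of_eq ?_)
  ring

/-! ### Derivatives -/

theorem _root_.Meromorphic.comp_add (hf : Meromorphic f) (a : ℂ) :
    Meromorphic fun z => f (z + a) :=
  Meromorphic.meromorphic_fun_comp_add_const_iff_meromorphic.2 hf

/-- Differentiation turns a pole of order ν into one of order ν+1 ≤ 2ν and creates no new poles. -/
theorem negPart_divisor_deriv_le (hf : Meromorphic f) :
    (divisor (deriv f) Set.univ)⁻ ≤ 2 • (divisor f Set.univ)⁻ := by
  intro z
  have e1 : (divisor (deriv f) Set.univ)⁻ z = (divisor (deriv f) Set.univ z)⁻ := rfl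
  have e2 : (2 • (divisor f Set.univ)⁻) z = 2 • (divisor f Set.univ z)⁻ := rfl
  rw [e1, e2, divisor_apply hf.deriv.meromorphicOn (Set.mem_univ z),
    divisor_apply hf.meromorphicOn (Set.mem_univ z)]
  rcases lt_or_ge (meromorphicOrderAt f z) 0 with h | h
  · obtain ⟨n, hn⟩ := WithTop.ne_top_iff_exists.1 (h.trans_le le_top).ne
    rw [← hn] at h
    have hn0 : n < 0 := by exact_mod_cast h
    rw [meromorphicOrderAt_deriv_eq_sub_one (n := n) (by exact_mod_cast hn0.ne) hn.symm, ← hn]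
    simp only [WithTop.untop₀_coe, negPart_eq_neg.2 hn0.le,
      negPart_eq_neg.2 (by omega : n - 1 ≤ 0)]
    rw [smul_neg, nsmul_eq_mul]
    push_cast
    omega
  · have hd : 0 ≤ meromorphicOrderAt (deriv f) z := by
      have h2 := (hf z).meromorphicOrderAt_nonneg_iff_analyticAt_toMeromorphicNFAt.1 h
      have h3 : deriv f =ᶠ[𝓝[≠] z] deriv (toMeromorphicNFAt f z) :=
        ((hf z).eq_nhdsNE_toMeromorphicNFAt).nhdsNE_deriv
      rw [meromorphicOrderAt_congr h3]
      exact h2.deriv.meromorphicOrderAt_nonneg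
    have : (meromorphicOrderAt (deriv f) z).untop₀⁻ = 0 :=
      negPart_eq_zero.2 (WithTop.untop₀_nonneg.2 hd)
    rw [this]
    exact nsmul_nonneg (negPart_nonneg _) 2

theorem logCounting_deriv_le (hf : Meromorphic f) {r : ℝ} (hr : 1 ≤ r) :
    ValueDistribution.logCounting (deriv f) ⊤ r ≤ 2 * ValueDistribution.logCounting f ⊤ r := by
  rw [logCounting_top, logCounting_top]
  refine (Function.locallyFinsuppWithin.logCounting_le (negPart_divisor_deriv_le hf) hr).trans ?_
  rw [map_nsmul]
  simp

theorem isBigO_T_of_meroEq_zero {g : ℂ → ℂ} (hg : MeroEq g 0) {s : ℝ} :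
    T g =O[atTop] fun r : ℝ => r ^ s := by
  refine IsBigO.of_bound 0 ?_
  filter_upwards [eventually_gt_atTop 0] with r hr
  rw [T, characteristic_congr_codiscrete hg hr.ne']
  simp [characteristic, Pi.zero_def, -Pi.zero_apply, proximity_const]

theorem isBigO_proximity_congr {g h : ℂ → ℂ} (hgh : g =ᶠ[codiscrete ℂ] h) {k : ℝ → ℝ}
    (hk : proximity h ⊤ =O[atTop] k) : proximity g ⊤ =O[atTop] k := by
  refine hk.congr' ?_ .rfl
  filter_upwards [eventually_gt_atTop 0] with r hr
  exact (proximity_congr_codiscrete hgh hr.ne').symm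

theorem isBigO_proximity_mul {g h : ℂ → ℂ} (hg : Meromorphic g) (hh : Meromorphic h) {k : ℝ → ℝ}
    (hgk : proximity g ⊤ =O[atTop] k) (hhk : proximity h ⊤ =O[atTop] k) :
    proximity (g * h) ⊤ =O[atTop] k :=
  isBigO_of_eventually_nonneg_le (.of_forall fun r => proximity_nonneg r)
    (.of_forall fun r => proximity_mul_top_le hg hh r) (hgk.add hhk)

/-- The proximity function is handled by f' = (f'/f)·f, the counting function by doubling the poles;
f ≡ 0 is separated because the factorization needs f to be nonzero. -/
theorem isBigO_T_deriv (hf : Meromorphic f) (ht : 0 ≤ t)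
    (hT : T f =O[atTop] fun r : ℝ => r ^ t) : T (deriv f) =O[atTop] fun r : ℝ => r ^ t := by
  by_cases h : MeroEq f 0
  · refine isBigO_T_of_meroEq_zero ?_
    rw [MeroEq, EventuallyEq] at h ⊢
    filter_upwards [eventually_codiscrete_eventually_nhds h] with z hz
    simpa [Pi.zero_def] using EventuallyEq.deriv_eq hz
  have h0 := hf.meromorphicOrderAt_ne_top_of_not_meroEq h
  have hprox : proximity (deriv f) ⊤ =O[atTop] fun r : ℝ => r ^ t := by
    have h1 : deriv f =ᶠ[codiscrete ℂ] (fun z => deriv f (z + 0) / f (z + 0)) * f := by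
      filter_upwards [hf.eventually_codiscrete_ne_zero h0] with z hz
      simp [hz]
    refine isBigO_proximity_congr h1 (isBigO_proximity_mul ?_ hf ?_ (isBigO_proximity hT))
    · exact (hf.deriv.comp_add 0).div (hf.comp_add 0)
    · exact (isBigO_proximity_deriv_div_shift hf h0 ht hT one_half_pos one_half_lt_one 0).trans
        (isBigO_rpow_rpow (by linarith))
  have hN : ValueDistribution.logCounting (deriv f) ⊤ =O[atTop] fun r : ℝ => r ^ t := by
    refine isBigO_of_eventually_nonneg_le ?_ ?_ (hT.const_mul_left 2)
    · filter_upwards [eventually_ge_atTop 1] with r hr using logCounting_nonneg hr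
    · filter_upwards [eventually_ge_atTop 1] with r hr
      exact (logCounting_deriv_le hf hr).trans (by gcongr; exact logCounting_le_T f r)
  exact hprox.add hN

theorem _root_.Meromorphic.iteratedDeriv (hf : Meromorphic f) (j : ℕ) :
    Meromorphic (iteratedDeriv j f) := by
  rw [iteratedDeriv_eq_iterate]
  exact hf.iterated_deriv

theorem isBigO_T_iteratedDeriv (hf : Meromorphic f) (ht : 0 ≤ t)
    (hT : T f =O[atTop] fun r : ℝ => r ^ t) (j : ℕ) :
    T (iteratedDeriv j f) =O[atTop] fun r : ℝ => r ^ t := by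
  induction j with
  | zero => simpa using hT
  | succ j ih =>
    rw [iteratedDeriv_succ]
    exact isBigO_T_deriv (hf.iteratedDeriv j) ht ih

/-- Induction through f^{(j+1)}(z+a)/f(z+b) = (f^{(j+1)}/f^{(j)})(z+a) · f^{(j)}(z+a)/f(z+b), the
first factor being a logarithmic derivative of a function that still has characteristic O(r^t). If
f^{(j)} ≡ 0 the next quotient vanishes. -/
theorem isBigO_proximity_iteratedDeriv_div_shift (hf : Meromorphic f)
    (h0 : ∀ z, meromorphicOrderAt f z ≠ ⊤) (ht : 0 ≤ t) (hT : T f =O[atTop] fun r : ℝ => r ^ t)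
    {α : ℝ} (hα0 : 0 < α) (hα1 : α < 1) (a b : ℂ) (j : ℕ) :
    proximity (fun z => iteratedDeriv j f (z + a) / f (z + b)) ⊤
      =O[atTop] fun r : ℝ => r ^ (t - α) := by
  induction j with
  | zero => simpa using isBigO_proximity_div_shift hf h0 ht hT hα0 hα1 a b
  | succ j ih =>
    by_cases h : MeroEq (iteratedDeriv j f) 0
    · have h1 : (fun z => iteratedDeriv (j + 1) f (z + a) / f (z + b))
          =ᶠ[codiscrete ℂ] fun _ => (0 : ℂ) := by
        filter_upwards [eventually_codiscrete_comp_add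
          (eventually_codiscrete_eventually_nhds h) a] with z hz
        have : deriv (iteratedDeriv j f) (z + a) = 0 := by
          simpa [Pi.zero_def] using EventuallyEq.deriv_eq hz
        rw [iteratedDeriv_succ, this, zero_div]
      refine isBigO_proximity_congr h1 (IsBigO.of_bound 0 ?_)
      simp
    · have hj := hf.iteratedDeriv j
      have hj0 := hj.meromorphicOrderAt_ne_top_of_not_meroEq h
      have h1 : (fun z => iteratedDeriv (j + 1) f (z + a) / f (z + b)) =ᶠ[codiscrete ℂ]
          (fun z => deriv (iteratedDeriv j f) (z + a) / iteratedDeriv j f (z + a)) *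
          (fun z => iteratedDeriv j f (z + a) / f (z + b)) := by
        filter_upwards [eventually_codiscrete_comp_add (hj.eventually_codiscrete_ne_zero hj0) a]
          with z hz
        rw [iteratedDeriv_succ, Pi.mul_apply, div_mul_div_cancel₀ hz]
      exact isBigO_proximity_congr h1 (isBigO_proximity_mul
        ((hj.deriv.comp_add a).div (hj.comp_add a)) ((hj.comp_add a).div (hf.comp_add b))
        (isBigO_proximity_deriv_div_shift hj hj0 ht (isBigO_T_iteratedDeriv hf ht hT j) hα0 hα1 a)
        ih)

end DiffDiff

end

noncomputable section

open Real Metric MeromorphicOn ValueDistribution InnerProductSpace Asymptotics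

namespace DiffDiff

/-! ### Orders and types as growth estimates -/

theorem le_rpow_of_posLog_div_log_le {x r t : ℝ} (hr : 1 < r) (h : log⁺ x / log r ≤ t) :
    x ≤ r ^ t := by
  have hr0 : 0 < r := by linarith
  rcases le_or_gt x 0 with hx | hx
  · exact hx.trans (rpow_nonneg hr0.le t)
  · rw [div_le_iff₀ (log_pos hr)] at h
    have h1 : log x ≤ log (r ^ t) := by
      rw [log_rpow hr0]
      exact (le_max_right _ _).trans h
    exact (log_le_log_iff hx (rpow_pos_of_pos hr0 t)).1 h1

theorem rpow_le_of_lt_posLog_div_log {x r t : ℝ} (hr : 1 < r) (ht : 0 ≤ t) (hx : 0 ≤ x)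
    (h : t < log⁺ x / log r) : r ^ t ≤ x := by
  have hr0 : 0 < r := by linarith
  rw [lt_div_iff₀ (log_pos hr), posLog, lt_max_iff] at h
  have h0 : 0 ≤ t * log r := mul_nonneg ht (log_nonneg hr.le)
  rcases h with h | h
  · linarith
  · have hx' : 0 < x := hx.lt_of_ne (by rintro rfl; simp at h; linarith)
    rw [← log_rpow hr0] at h
    exact (log_le_log_iff (rpow_pos_of_pos hr0 t) hx').1 h.le

theorem isBigO_of_limsup_posLog_lt {g : ℝ → ℝ} {t : ℝ} (hg : ∀ᶠ r in atTop, 0 ≤ g r)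
    (h : limsup (fun r : ℝ => ENNReal.ofReal (log⁺ (g r) / log r)) atTop < ENNReal.ofReal t) :
    g =O[atTop] fun r : ℝ => r ^ t := by
  refine isBigO_of_eventually_nonneg_le hg ?_ (isBigO_refl _ _)
  filter_upwards [eventually_lt_of_limsup_lt h, eventually_gt_atTop 1] with r h1 hr
  exact le_rpow_of_posLog_div_log_le hr (ENNReal.ofReal_lt_ofReal_iff'.1 h1).1.le

theorem eventually_T_nonneg (f : ℂ → ℂ) : ∀ᶠ r in atTop, 0 ≤ T f r := by
  filter_upwards [eventually_ge_atTop 1] with r hr using characteristic_nonneg hr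

variable {f : ℂ → ℂ} {t : ℝ}

theorem isBigO_T_of_order_lt (h : order f < ENNReal.ofReal t) :
    T f =O[atTop] fun r : ℝ => r ^ t :=
  isBigO_of_limsup_posLog_lt (eventually_T_nonneg f) h

theorem isBigO_logCounting_of_convergenceExponent_lt
    (h : convergenceExponent f⁻¹ < ENNReal.ofReal t) :
    ValueDistribution.logCounting f ⊤ =O[atTop] fun r : ℝ => r ^ t := by
  have e : ValueDistribution.logCounting f⁻¹ 0 = ValueDistribution.logCounting f ⊤ := by
    rw [← logCounting_inv, inv_inv]
  rw [convergenceExponent, e] at h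
  exact isBigO_of_limsup_posLog_lt logCounting_eventually_nonneg h

theorem eventually_rpow_le_T (ht : 0 ≤ t) (h : ENNReal.ofReal t < lowerOrder f) :
    ∀ᶠ r in atTop, r ^ t ≤ T f r := by
  filter_upwards [eventually_lt_of_lt_liminf h, eventually_gt_atTop 1, eventually_T_nonneg f]
    with r h1 hr h2
  exact rpow_le_of_lt_posLog_div_log hr ht h2 (ENNReal.ofReal_lt_ofReal_iff'.1 h1).1

theorem frequently_T_le_rpow (h : lowerOrder f < ENNReal.ofReal t) :
    ∃ᶠ r in atTop, T f r ≤ r ^ t := by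
  refine ((frequently_lt_of_liminf_lt (by isBoundedDefault) h).and_eventually
    (eventually_gt_atTop 1)).mono fun r hr => ?_
  exact le_rpow_of_posLog_div_log_le hr.2 (ENNReal.ofReal_lt_ofReal_iff'.1 hr.1).1.le

theorem eventually_mul_rpow_le_T {b : ℝ} (h : ENNReal.ofReal b < lowerType f) :
    ∀ᶠ r in atTop, b * r ^ (lowerOrder f).toReal ≤ T f r := by
  filter_upwards [eventually_lt_of_lt_liminf h, eventually_gt_atTop 0] with r h1 hr
  exact ((lt_div_iff₀ (rpow_pos_of_pos hr _)).1 (ENNReal.ofReal_lt_ofReal_iff'.1 h1).1).le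

theorem frequently_T_le_mul_rpow {b : ℝ} (h : lowerType f < ENNReal.ofReal b) :
    ∃ᶠ r in atTop, T f r ≤ b * r ^ (lowerOrder f).toReal := by
  refine ((frequently_lt_of_liminf_lt (by isBoundedDefault) h).and_eventually
    (eventually_gt_atTop 0)).mono fun r hr => ?_
  exact ((div_lt_iff₀ (rpow_pos_of_pos hr.2 _)).1 (ENNReal.ofReal_lt_ofReal_iff'.1 hr.1).1).le

theorem eventually_T_le_mul_rpow {b : ℝ} (h : type f < ENNReal.ofReal b) :
    ∀ᶠ r in atTop, T f r ≤ b * r ^ (order f).toReal := by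
  filter_upwards [eventually_lt_of_limsup_lt h, eventually_gt_atTop 0] with r h1 hr
  exact ((div_lt_iff₀ (rpow_pos_of_pos hr _)).1 (ENNReal.ofReal_lt_ofReal_iff'.1 h1).1).le

theorem eventually_le_mul_rpow_of_isBigO {g : ℝ → ℝ} {s M : ℝ} (hs : s < M)
    (hg : g =O[atTop] fun r : ℝ => r ^ s) {ε : ℝ} (hε : 0 < ε) :
    ∀ᶠ r in atTop, g r ≤ ε * r ^ M := by
  have h0 : (fun r : ℝ => r ^ s) =o[atTop] fun r : ℝ => r ^ M := by
    refine isLittleO_of_tendsto' ?_ ?_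
    · filter_upwards [eventually_gt_atTop 0] with r hr h
      exact absurd h (rpow_pos_of_pos hr M).ne'
    · refine (tendsto_rpow_neg_atTop (sub_pos.2 hs)).congr' ?_
      filter_upwards [eventually_gt_atTop 0] with r hr
      rw [neg_sub, rpow_sub hr]
  have h1 := (hg.trans_isLittleO h0).bound hε
  filter_upwards [h1, eventually_ge_atTop 0] with r h2 hr
  rw [norm_of_nonneg (rpow_nonneg hr M)] at h2
  exact (le_norm_self _).trans h2

theorem exists_ofReal_between {x y : ENNReal} (h : x < y) :
    ∃ s : ℝ, 0 < s ∧ x < ENNReal.ofReal s ∧ ENNReal.ofReal s < y := by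
  obtain ⟨z, hxz, hzy⟩ := exists_between h
  have hz : z ≠ ⊤ := (hzy.trans_le le_top).ne
  refine ⟨z.toReal, ENNReal.toReal_pos (pos_of_gt hxz).ne' hz, ?_, ?_⟩ <;>
  rwa [ENNReal.ofReal_toReal hz]

theorem lt_toReal_of_ofReal_lt {s : ℝ} (hs : 0 < s) {y : ENNReal} (hy : y ≠ ⊤)
    (h : ENNReal.ofReal s < y) : s < y.toReal :=
  (ENNReal.ofReal_lt_iff_lt_toReal hs.le hy).1 h

theorem lt_ofReal_toReal_add {x : ENNReal} (hx : x ≠ ⊤) {ε : ℝ} (hε : 0 < ε) :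
    x < ENNReal.ofReal (x.toReal + ε) :=
  (ENNReal.lt_ofReal_iff_toReal_lt hx).2 (by linarith)

open Classical in
-- A function of order below μ has T(r,f) = o(r^μ), so it may be given type 0 at the scale r^μ. This
-- treats all coefficients uniformly, whether or not they enter τ₁.
theorem eventually_T_le_of_order_le {μ : ENNReal} (hμ : μ ≠ ⊤) (h : order f ≤ μ)
    (hτ : (if order f = μ then type f else 0) ≠ ⊤) {ε : ℝ} (hε : 0 < ε) :
    ∀ᶠ r in atTop,
      T f r ≤ ((if order f = μ then type f else 0 : ENNReal).toReal + ε) * r ^ μ.toReal := by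
  by_cases he : order f = μ
  · rw [if_pos he] at hτ ⊢
    have := eventually_T_le_mul_rpow (lt_ofReal_toReal_add hτ hε)
    rwa [he] at this
  · rw [if_neg he]
    obtain ⟨s, hs, h1, h2⟩ := exists_ofReal_between (lt_of_le_of_ne h he)
    simpa using eventually_le_mul_rpow_of_isBigO (lt_toReal_of_ofReal_lt hs hμ h2)
      (isBigO_T_of_order_lt h1) hε

open Classical in
theorem frequently_T_le_of_lowerOrder_le {μ : ENNReal} (hμ : μ ≠ ⊤) (h : lowerOrder f ≤ μ)
    (hτ : (if lowerOrder f = μ then lowerType f else 0) ≠ ⊤) {ε : ℝ} (hε : 0 < ε) :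
    ∃ᶠ r in atTop,
      T f r ≤ ((if lowerOrder f = μ then lowerType f else 0 : ENNReal).toReal + ε)
        * r ^ μ.toReal := by
  by_cases he : lowerOrder f = μ
  · rw [if_pos he] at hτ ⊢
    have := frequently_T_le_mul_rpow (lt_ofReal_toReal_add hτ hε)
    rwa [he] at this
  · rw [if_neg he]
    obtain ⟨s, hs, h1, h2⟩ := exists_ofReal_between (lt_of_le_of_ne h he)
    have h3 := eventually_le_mul_rpow_of_isBigO (lt_toReal_of_ofReal_lt hs hμ h2)
      (isBigO_refl _ _) hε
    refine ((frequently_T_le_rpow h1).and_eventually h3).mono fun r hr => ?_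
    simpa using hr.1.trans hr.2

theorem exists_pos_add_mul_lt {x b N : ℝ} (h : x < b) (hN : 0 ≤ N) :
    ∃ ε > 0, x + N * ε < b := by
  refine ⟨(b - x) / (N + 1), div_pos (by linarith) (by linarith), ?_⟩
  have h1 : N / (N + 1) < 1 := (div_lt_one (by linarith)).2 (by linarith)
  have h2 : N * ((b - x) / (N + 1)) = N / (N + 1) * (b - x) := by ring
  rw [h2]
  nlinarith

/-! ### The dominant coefficient -/

section Dominant

variable {n m : ℕ} {A : Fin (n + 1) → Fin (m + 1) → ℂ → ℂ} {F : ℂ → ℂ}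
  {k l : Fin (n + 1)} {p : Fin (m + 1)}

theorem order_le_maxOrder {q : Fin (n + 1) × Fin (m + 1)} (hq : q ∈ otherIndices l k p) :
    order (A q.1 q.2) ≤ maxOrder A F l k p := by
  rw [maxOrder]
  exact le_max_of_le_right
    (Finset.le_sup (f := fun q : Fin (n + 1) × Fin (m + 1) => order (A q.1 q.2)) hq)

/-- Under strict inequality of orders nothing is known about the lower type of A_{l0}, which may be
0. Two exponents t < t' below μ(A_{l0}) separate the sides instead: the right side is O(r^t) on an
unbounded set of r, the left is eventually at least r^{t'}. -/
theorem not_eventually_le_of_order_lt (h1 : max (lowerOrder (A k p)) (maxOrder A F l k p)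
      < lowerOrder (A l 0)) (hμ : lowerOrder (A l 0) < ⊤) {E : ℝ → ℝ} {s : ℝ}
    (hs : s < (lowerOrder (A l 0)).toReal) (hE : E =O[atTop] fun r : ℝ => r ^ s) :
    ¬ ∀ᶠ r in atTop, T (A l 0) r ≤
      T (A k p) r + ∑ q ∈ otherIndices l k p, T (A q.1 q.2) r + T F r + E r := by
  intro hle
  have h2 : max (max (lowerOrder (A k p)) (maxOrder A F l k p)) (ENNReal.ofReal s)
      < lowerOrder (A l 0) := max_lt h1 (by
    rcases le_or_gt s 0 with h | h
    · rw [ENNReal.ofReal_of_nonpos h]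
      exact pos_of_gt h1
    · rwa [ENNReal.ofReal_lt_iff_lt_toReal h.le hμ.ne])
  obtain ⟨t, ht, h3, h4⟩ := exists_ofReal_between h2
  obtain ⟨t', ht', h5, h6⟩ := exists_ofReal_between h4
  have htt' : t < t' := (ENNReal.ofReal_lt_ofReal_iff ht').1 h5
  have hβ : maxOrder A F l k p < ENNReal.ofReal t :=
    ((le_max_right _ _).trans (le_max_left _ _)).trans_lt h3
  have hst : s ≤ t := (ENNReal.ofReal_lt_ofReal_iff ht).1 ((le_max_right _ _).trans_lt h3) |>.le
  have hO : (fun r : ℝ => r ^ t + ∑ q ∈ otherIndices l k p, T (A q.1 q.2) r + T F r + E r)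
      =O[atTop] fun r : ℝ => r ^ t := by
    refine (((isBigO_refl _ _).add (IsBigO.fun_sum fun q hq => ?_)).add ?_).add
      (hE.trans (isBigO_rpow_rpow hst))
    · exact isBigO_T_of_order_lt ((order_le_maxOrder hq).trans_lt hβ)
    · exact isBigO_T_of_order_lt ((le_max_left _ _).trans_lt hβ)
  have h7 := eventually_le_mul_rpow_of_isBigO htt' hO one_half_pos
  have h8 := frequently_T_le_rpow
    (((le_max_left _ _).trans (le_max_left _ _)).trans_lt h3 : lowerOrder (A k p) < _)
  obtain ⟨r, h9, h10, h11, h12, h13⟩ := (h8.and_eventually (hle.and (h7.and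
    ((eventually_rpow_le_T ht'.le h6).and (eventually_gt_atTop 0))))).exists
  have := rpow_pos_of_pos h13 t'
  linarith

open Classical in
theorem not_eventually_le_of_typeSum_lt
    (h1 : max (lowerOrder (A k p)) (maxOrder A F l k p) ≤ lowerOrder (A l 0))
    (hμ : lowerOrder (A l 0) < ⊤)
    (h2 : typeSum A F l k p + (if lowerOrder (A k p) = lowerOrder (A l 0)
      then lowerType (A k p) else 0) < lowerType (A l 0)) {E : ℝ → ℝ} {s : ℝ}
    (hs : s < (lowerOrder (A l 0)).toReal) (hE : E =O[atTop] fun r : ℝ => r ^ s) :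
    ¬ ∀ᶠ r in atTop, T (A l 0) r ≤
      T (A k p) r + ∑ q ∈ otherIndices l k p, T (A q.1 q.2) r + T F r + E r := by
  intro hle
  set μ := lowerOrder (A l 0) with hμdef
  set κ : ENNReal := if lowerOrder (A k p) = μ then lowerType (A k p) else 0 with hκ
  set τ : (ℂ → ℂ) → ENNReal := fun S => if order S = μ then type S else 0 with hτ
  have hsum : typeSum A F l k p = ∑ q ∈ otherIndices l k p, τ (A q.1 q.2) + τ F := by
    rw [typeSum, Finset.sum_filter]
  obtain ⟨b, hb, h3, h4⟩ := exists_ofReal_between h2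
  have hfin : typeSum A F l k p + κ ≠ ⊤ := (h3.trans_le le_top).ne
  have hκfin : κ ≠ ⊤ := (ENNReal.add_ne_top.1 hfin).2
  have htfin : typeSum A F l k p ≠ ⊤ := (ENNReal.add_ne_top.1 hfin).1
  rw [hsum] at htfin
  have hFfin : τ F ≠ ⊤ := (ENNReal.add_ne_top.1 htfin).2
  have hAfin : ∀ q ∈ otherIndices l k p, τ (A q.1 q.2) ≠ ⊤ :=
    ENNReal.sum_ne_top.1 (ENNReal.add_ne_top.1 htfin).1
  have h5 : ∑ q ∈ otherIndices l k p, (τ (A q.1 q.2)).toReal + (τ F).toReal + κ.toReal < b := by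
    have := (ENNReal.lt_ofReal_iff_toReal_lt hfin).1 h3
    rwa [hsum, ENNReal.toReal_add htfin hκfin, ENNReal.toReal_add
      (ENNReal.add_ne_top.1 htfin).1 hFfin, ENNReal.toReal_sum hAfin] at this
  obtain ⟨ε, hε, hεX⟩ :=
    -- One ε for each remaining coefficient and one each for A_{kp}, F and the error E.
    exists_pos_add_mul_lt h5 (N := (otherIndices l k p).card + 3)
      (add_nonneg (Nat.cast_nonneg _) (by norm_num))
  have hβ : maxOrder A F l k p ≤ μ := (le_max_right _ _).trans h1
  have eA : ∀ᶠ r in atTop, ∀ q ∈ otherIndices l k p,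
      T (A q.1 q.2) r ≤ ((τ (A q.1 q.2)).toReal + ε) * r ^ μ.toReal := by
    rw [eventually_all_finset]
    exact fun q hq => eventually_T_le_of_order_le hμ.ne ((order_le_maxOrder hq).trans hβ)
      (hAfin q hq) hε
  have eF := eventually_T_le_of_order_le hμ.ne ((le_max_left _ _).trans hβ) hFfin hε
  have eE := eventually_le_mul_rpow_of_isBigO hs hE hε
  have eL := eventually_mul_rpow_le_T h4
  have eK := frequently_T_le_of_lowerOrder_le hμ.ne ((le_max_left _ _).trans h1) hκfin hε
  obtain ⟨r, g1, g2, g3, g4, g5, g6, g7⟩ := (eK.and_eventually (hle.and (eA.and (eF.and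
    (eE.and (eL.and (eventually_gt_atTop 0))))))).exists
  have hpos := rpow_pos_of_pos g7 μ.toReal
  have g8 : ∑ q ∈ otherIndices l k p, T (A q.1 q.2) r
      ≤ (∑ q ∈ otherIndices l k p, (τ (A q.1 q.2)).toReal + (otherIndices l k p).card * ε)
        * r ^ μ.toReal := by
    refine (Finset.sum_le_sum fun q hq => g3 q hq).trans (le_of_eq ?_)
    rw [← Finset.sum_mul, Finset.sum_add_distrib, Finset.sum_const, nsmul_eq_mul]
  have g9 := g6.trans (g2.trans (add_le_add (add_le_add (add_le_add g1 g8) g4) g5))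
  rw [← add_mul, ← add_mul, ← add_mul] at g9
  have g10 : b ≤ κ.toReal + ε + (∑ q ∈ otherIndices l k p, (τ (A q.1 q.2)).toReal +
      (otherIndices l k p).card * ε) + ((τ F).toReal + ε) + ε := le_of_mul_le_mul_right g9 hpos
  clear_value κ τ μ
  linarith

theorem not_eventually_T_le
    (h1 : max (lowerOrder (A k p)) (maxOrder A F l k p) ≤ lowerOrder (A l 0))
    (h1' : lowerOrder (A l 0) < ⊤)
    (h2 : lowerOrder (A l 0) = lowerOrder (A k p) → lowerType (A k p) < lowerType (A l 0))
    (h3 : lowerOrder (A l 0) = maxOrder A F l k p →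
      typeSum A F l k p < lowerType (A l 0))
    (h4 : lowerOrder (A l 0) = lowerOrder (A k p) → lowerOrder (A l 0) = maxOrder A F l k p →
      typeSum A F l k p + lowerType (A k p) < lowerType (A l 0)) {E : ℝ → ℝ} {s : ℝ}
    (hs : s < (lowerOrder (A l 0)).toReal) (hE : E =O[atTop] fun r : ℝ => r ^ s) :
    ¬ ∀ᶠ r in atTop, T (A l 0) r ≤
      T (A k p) r + ∑ q ∈ otherIndices l k p, T (A q.1 q.2) r + T F r + E r := by
  classical
  by_cases hk : lowerOrder (A l 0) = lowerOrder (A k p)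
  · refine not_eventually_le_of_typeSum_lt h1 h1' ?_ hs hE
    rw [if_pos hk.symm]
    by_cases hβ : lowerOrder (A l 0) = maxOrder A F l k p
    · exact h4 hk hβ
    · have hlt := lt_of_le_of_ne ((le_max_right _ _).trans h1) (Ne.symm hβ)
      -- When β < μ(A_{l0}) no function has order μ(A_{l0}), so τ₁ is an empty sum and the second
      -- hypothesis suffices.
      have h0 : typeSum A F l k p = 0 := by
        rw [typeSum, if_neg ((le_max_left _ _).trans_lt hlt).ne, add_zero, Finset.sum_filter]
        exact Finset.sum_eq_zero fun q hq => if_neg ((order_le_maxOrder hq).trans_lt hlt).ne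
      rw [h0, zero_add]
      exact h2 hk
  · by_cases hβ : lowerOrder (A l 0) = maxOrder A F l k p
    · refine not_eventually_le_of_typeSum_lt h1 h1' ?_ hs hE
      rw [if_neg (Ne.symm hk), add_zero]
      exact h3 hβ
    · refine not_eventually_le_of_order_lt (lt_of_le_of_ne h1 ?_) h1' hs hE
      rcases max_choice (lowerOrder (A k p)) (maxOrder A F l k p) with h | h <;> rw [h]
      · exact Ne.symm hk
      · exact Ne.symm hβ

/-! ### The equation divided by a shift of the solution -/

/-- The function `g` stands for 1/f(z+c_l), but only its product with F matters. When F ≡ 0 one may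
take g = 0, avoiding m(r,1/f(z+c_l)), for which no bound below order μ(A_{l0}) is available then. -/
theorem eventually_T_le_of_equation (hA : ∀ i j, Meromorphic (A i j)) (hF : Meromorphic F)
    (hne : (k, p) ≠ (l, 0)) {c : Fin (n + 1) → ℂ} (hsol : IsMeroSolution A c F f)
    (h0 : ∀ z, meromorphicOrderAt f z ≠ ⊤) {g : ℂ → ℂ} (hg : Meromorphic g)
    (hFg : ∀ᶠ z in codiscrete ℂ, F z * (f (z + c l))⁻¹ = F z * g z) {s : ℝ} (hs : 0 ≤ s)
    (hG : ∀ (i : Fin (n + 1)) (j : Fin (m + 1)),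
      proximity (fun z => iteratedDeriv j f (z + c i) / f (z + c l)) ⊤ =O[atTop]
        fun r : ℝ => r ^ s)
    (hgs : proximity g ⊤ =O[atTop] fun r : ℝ => r ^ s)
    (hN : ValueDistribution.logCounting (A l 0) ⊤ =O[atTop] fun r : ℝ => r ^ s) :
    ∃ E : ℝ → ℝ, E =O[atTop] (fun r : ℝ => r ^ s) ∧ ∀ᶠ r in atTop, T (A l 0) r ≤
      T (A k p) r + ∑ q ∈ otherIndices l k p, T (A q.1 q.2) r + T F r + E r := by
  classical
  obtain ⟨hf, heq⟩ := hsol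
  set G : Fin (n + 1) × Fin (m + 1) → ℂ → ℂ :=
    fun q => -fun z => iteratedDeriv (q.2 : ℕ) f (z + c q.1) / f (z + c l) with hGdef
  have hGm : ∀ q, Meromorphic (G q) := fun q =>
    (((hf.iteratedDeriv _).comp_add _).div (hf.comp_add _)).neg
  have hGO : ∀ q, proximity (G q) ⊤ =O[atTop] fun r : ℝ => r ^ s := fun q => by
    have : proximity (G q) ⊤
        = proximity (fun z => iteratedDeriv (q.2 : ℕ) f (z + c q.1) / f (z + c l)) ⊤ := by
      simp [proximity_top, hGdef]
    rw [this]
    exact hG q.1 q.2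
  set U : Finset (Fin (n + 1) × Fin (m + 1)) := Finset.univ.erase (l, 0) with hU
  have hUins : U = insert (k, p) (otherIndices l k p) := by
    ext q
    simp only [hU, otherIndices, Finset.mem_erase, Finset.mem_univ, and_true, Finset.mem_insert,
      Finset.mem_filter, true_and]
    by_cases hq : q = (k, p)
    · simp [hq, hne]
    · simp [hq]
  have hknot : (k, p) ∉ otherIndices l k p := by simp [otherIndices]
  have hid : A l 0 =ᶠ[codiscrete ℂ]
      F * g + ∑ q ∈ U, A q.1 q.2 * G q := by
    filter_upwards [heq, hFg, eventually_codiscrete_comp_add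
      (hf.eventually_codiscrete_ne_zero h0) (c l)] with z hz hz2 hz3
    rw [diffDiffOp, ← Fintype.sum_prod_type' (fun i (j : Fin (m + 1)) =>
        A i j z * iteratedDeriv (j : ℕ) f (z + c i)),
      ← Finset.add_sum_erase _ _ (Finset.mem_univ (l, (0 : Fin (m + 1))))] at hz
    simp only [Fin.val_zero, iteratedDeriv_zero] at hz
    simp only [Pi.add_apply, Pi.mul_apply, Finset.sum_apply, hGdef, Pi.neg_apply]
    rw [← hz2, ← hz, add_mul, mul_assoc, mul_inv_cancel₀ hz3, mul_one, Finset.sum_mul, add_assoc,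
      ← Finset.sum_add_distrib]
    rw [Finset.sum_eq_zero, add_zero]
    intro q _
    ring
  -- The constants log 2 and log |U| are the costs of the proximity function of a sum of 2 and of
  -- |U| terms.
  refine ⟨fun r => ∑ q ∈ U, proximity (G q) ⊤ r + proximity g ⊤ r + log 2 + log U.card +
    ValueDistribution.logCounting (A l 0) ⊤ r, ?_, ?_⟩
  · exact ((((IsBigO.fun_sum fun q _ => hGO q).add hgs).add (isBigO_const_rpow _ hs)).add
      (isBigO_const_rpow _ hs)).add hN
  · filter_upwards [eventually_ge_atTop 1] with r hr
    have hmul : ∀ q ∈ U, Meromorphic (A q.1 q.2 * G q) := fun q _ => (hA _ _).mul (hGm q)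
    have e1 : proximity (A l 0) ⊤ r ≤ proximity F ⊤ r + proximity g ⊤ r +
        (∑ q ∈ U, (proximity (A q.1 q.2) ⊤ r + proximity (G q) ⊤ r) + log U.card) + log 2 := by
      rw [proximity_congr_codiscrete hid (by linarith)]
      refine (proximity_add_top_le (hF.mul hg) (Meromorphic.sum hmul) r).trans ?_
      have e2 := proximity_mul_top_le hF hg r
      have e3 := proximity_sum_top_le U (fun q => A q.1 q.2 * G q) hmul r
      have e4 : ∑ q ∈ U, proximity (A q.1 q.2 * G q) ⊤ r
          ≤ ∑ q ∈ U, (proximity (A q.1 q.2) ⊤ r + proximity (G q) ⊤ r) :=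
        Finset.sum_le_sum fun q _ => proximity_mul_top_le (hA q.1 q.2) (hGm q) r
      simp only [Pi.add_apply, Finset.sum_apply] at e2 e3 ⊢
      linarith
    have e5 : ∑ q ∈ U, proximity (A q.1 q.2) ⊤ r
        ≤ T (A k p) r + ∑ q ∈ otherIndices l k p, T (A q.1 q.2) r := by
      rw [hUins, Finset.sum_insert hknot]
      exact add_le_add (proximity_le_T _ hr) (Finset.sum_le_sum fun q _ => proximity_le_T _ hr)
    have e6 := proximity_le_T F hr
    rw [Finset.sum_add_distrib] at e1
    have e7 : T (A l 0) r = proximity (A l 0) ⊤ r +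
      ValueDistribution.logCounting (A l 0) ⊤ r := rfl
    rw [e7]
    linarith

end Dominant

theorem meroEq_diffDiffOp_zero {n m : ℕ} {A : Fin (n + 1) → Fin (m + 1) → ℂ → ℂ}
    {c : Fin (n + 1) → ℂ} (h : MeroEq f 0) : MeroEq (diffDiffOp A c f) 0 := by
  have hj : ∀ j : ℕ, ∀ᶠ z in codiscrete ℂ, iteratedDeriv j f z = 0 := by
    intro j
    induction j with
    | zero => simpa [MeroEq, EventuallyEq] using h
    | succ j ih =>
      filter_upwards [eventually_codiscrete_eventually_nhds ih] with z hz
      rw [iteratedDeriv_succ]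
      have hz' : iteratedDeriv j f =ᶠ[𝓝 z] fun _ => 0 := hz
      simpa using hz'.deriv_eq
  have hall : ∀ᶠ z in codiscrete ℂ, ∀ (i : Fin (n + 1)) (j : Fin (m + 1)),
      iteratedDeriv (j : ℕ) f (z + c i) = 0 :=
    eventually_all.2 fun i => eventually_all.2 fun j => eventually_codiscrete_comp_add (hj j) (c i)
  filter_upwards [hall] with z hz
  simp [diffDiffOp, hz]

end DiffDiff

end

/-! ### Lower bounds for the order of a solution -/

noncomputable section

open Real Metric MeromorphicOn ValueDistribution InnerProductSpace Asymptotics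

namespace DiffDiff

variable {n m : ℕ} {A : Fin (n + 1) → Fin (m + 1) → ℂ → ℂ} {F f : ℂ → ℂ}
  {k l : Fin (n + 1)} {p : Fin (m + 1)} {c : Fin (n + 1) → ℂ}

/-- The conclusion of `not_eventually_T_le`: the characteristics of the other coefficients cannot
dominate that of `A l 0`, even up to an error term of order less than `μ(A l 0)`. -/
def IsDominant (A : Fin (n + 1) → Fin (m + 1) → ℂ → ℂ) (F : ℂ → ℂ) (l k : Fin (n + 1))
    (p : Fin (m + 1)) : Prop :=
  ∀ (E : ℝ → ℝ) (s : ℝ), s < (lowerOrder (A l 0)).toReal → E =O[atTop] (fun r : ℝ => r ^ s) →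
    ¬ ∀ᶠ r in atTop, T (A l 0) r ≤
      T (A k p) r + ∑ q ∈ otherIndices l k p, T (A q.1 q.2) r + T F r + E r

theorem lowerOrder_le_order_of_isDominant (hA : ∀ i j, Meromorphic (A i j)) (hF : Meromorphic F)
    (hne : (k, p) ≠ (l, 0)) (hdom : IsDominant A F l k p) (hμ : lowerOrder (A l 0) < ⊤)
    (hconv : convergenceExponent (A l 0)⁻¹ < lowerOrder (A l 0)) (hF0 : ¬ MeroEq F 0)
    (hsol : IsMeroSolution A c F f) : lowerOrder (A l 0) ≤ order f := by
  by_contra! hlt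
  have hf0 : ¬ MeroEq f 0 := fun h => hF0 (hsol.2.symm.trans (meroEq_diffDiffOp_zero h))
  have hf := hsol.1
  have h0 := hf.meromorphicOrderAt_ne_top_of_not_meroEq hf0
  obtain ⟨t, ht, h1, h2⟩ := exists_ofReal_between (max_lt hlt hconv)
  have hT := isBigO_T_of_order_lt ((le_max_left _ _).trans_lt h1)
  have hN := isBigO_logCounting_of_convergenceExponent_lt ((le_max_right _ _).trans_lt h1)
  have hhalf : (fun r : ℝ => r ^ (t - 1 / 2)) =O[atTop] fun r : ℝ => r ^ t :=
    isBigO_rpow_rpow (by linarith)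
  have hinv : proximity (fun z => (f (z + c l))⁻¹) ⊤ =O[atTop] fun r : ℝ => r ^ t := by
    -- Writing 1/f(z+c_l) = (1/f(z)) · f(z)/f(z+c_l) avoids comparing the characteristics of `f` and
    -- of its shift.
    have hfac : (fun z => (f (z + c l))⁻¹)
        =ᶠ[codiscrete ℂ] f⁻¹ * fun z => f (z + 0) / f (z + c l) := by
      filter_upwards [hf.eventually_codiscrete_ne_zero h0] with z hz
      simp [div_eq_mul_inv, inv_mul_cancel_left₀ hz]
    exact isBigO_proximity_congr hfac (isBigO_proximity_mul hf.inv
      ((hf.comp_add 0).div (hf.comp_add (c l))) (isBigO_proximity (isBigO_T_inv hf ht.le hT))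
      ((isBigO_proximity_div_shift hf h0 ht.le hT one_half_pos one_half_lt_one 0 (c l)).trans
        hhalf))
  obtain ⟨E, hE, hle⟩ := eventually_T_le_of_equation hA hF hne hsol h0
    (hf.comp_add (c l)).inv (.of_forall fun _ => rfl) ht.le
    (fun i j => (isBigO_proximity_iteratedDeriv_div_shift hf h0 ht.le hT one_half_pos
      one_half_lt_one (c i) (c l) j).trans hhalf) hinv hN
  exact hdom E t (lt_toReal_of_ofReal_lt ht hμ.ne h2) hE hle

theorem lowerOrder_add_one_le_order_of_isDominant (hA : ∀ i j, Meromorphic (A i j))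
    (hF : Meromorphic F) (hne : (k, p) ≠ (l, 0)) (hdom : IsDominant A F l k p)
    (hμ : lowerOrder (A l 0) < ⊤)
    (hconv : convergenceExponent (A l 0)⁻¹ < lowerOrder (A l 0)) (hF0 : MeroEq F 0)
    (hsol : IsMeroSolution A c 0 f) (hf0 : ¬ MeroEq f 0) :
    lowerOrder (A l 0) + 1 ≤ order f := by
  by_contra! hlt
  have hf := hsol.1
  have h0 := hf.meromorphicOrderAt_ne_top_of_not_meroEq hf0
  set M := (lowerOrder (A l 0)).toReal with hM
  have hM0 : 0 < M := ENNReal.toReal_pos (pos_of_gt hconv).ne' hμ.ne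
  obtain ⟨t, ht, h1, h2⟩ := exists_ofReal_between hlt
  obtain ⟨u, hu, h3, h4⟩ := exists_ofReal_between hconv
  have htM : t < M + 1 := by
    have := lt_toReal_of_ofReal_lt ht (ENNReal.add_lt_top.2 ⟨hμ, ENNReal.one_lt_top⟩).ne h2
    rwa [ENNReal.toReal_add hμ.ne ENNReal.one_ne_top, ENNReal.toReal_one] at this
  have huM : u < M := lt_toReal_of_ofReal_lt hu hμ.ne h4
  have hT := isBigO_T_of_order_lt h1
  -- Possible because t < μ(A_{l0}) + 1; then t - α < μ(A_{l0}), which is how the extra 1 in the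
  -- bound arises.
  obtain ⟨α, hα, hα1⟩ : ∃ α, max (t - M) 0 < α ∧ α < 1 :=
    exists_between (max_lt (by linarith) one_pos)
  have hα0 : 0 < α := (le_max_right _ _).trans_lt hα
  have hαM : t - α < M := by linarith [(le_max_left (t - M) 0).trans_lt hα]
  have hgs : proximity (fun _ : ℂ => (0 : ℂ)) ⊤ =O[atTop] fun r : ℝ => r ^ max (t - α) u :=
    (isBigO_zero _ _).congr_left fun r => by simp [proximity_const]
  obtain ⟨E, hE, hle⟩ := eventually_T_le_of_equation hA hF hne
    ⟨hf, hsol.2.trans hF0.symm⟩ h0 (g := fun _ => 0) (Meromorphic.const 0)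
    (hF0.mono fun z hz => by simp [hz]) (hu.le.trans (le_max_right (t - α) u))
    (fun i j => (isBigO_proximity_iteratedDeriv_div_shift hf h0 ht.le hT hα0 hα1 (c i) (c l)
      j).trans (isBigO_rpow_rpow (le_max_left _ _))) hgs
    ((isBigO_logCounting_of_convergenceExponent_lt h3).trans
      (isBigO_rpow_rpow (le_max_right _ _)))
  exact hdom E _ (max_lt hαM huM) hE hle

end DiffDiff

end

theorem theorem1p2 (n m : ℕ)
    (A : Fin (n + 1) → Fin (m + 1) → ℂ → ℂ) (F : ℂ → ℂ) (c : Fin (n + 1) → ℂ)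
    (hA : ∀ i j, Meromorphic (A i j)) (hF : Meromorphic F) (hc : Function.Injective c)
    (k l : Fin (n + 1)) (p : Fin (m + 1))
    (h1 : max (DiffDiff.lowerOrder (A k p)) (DiffDiff.maxOrder A F l k p)
        ≤ DiffDiff.lowerOrder (A l 0))
    (h1' : DiffDiff.lowerOrder (A l 0) < ⊤)
    (h2 : DiffDiff.lowerOrder (A l 0) = DiffDiff.lowerOrder (A k p) →
        DiffDiff.lowerType (A k p) < DiffDiff.lowerType (A l 0))
    (h3 : DiffDiff.lowerOrder (A l 0) = DiffDiff.maxOrder A F l k p →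
        DiffDiff.typeSum A F l k p < DiffDiff.lowerType (A l 0) ∧
          DiffDiff.lowerType (A l 0) < ⊤)
    (h4 : DiffDiff.lowerOrder (A l 0) = DiffDiff.lowerOrder (A k p) →
        DiffDiff.lowerOrder (A l 0) = DiffDiff.maxOrder A F l k p →
        DiffDiff.typeSum A F l k p + DiffDiff.lowerType (A k p) < DiffDiff.lowerType (A l 0) ∧
          DiffDiff.lowerType (A l 0) < ⊤)
    (h5 : DiffDiff.convergenceExponent (A l 0)⁻¹ < DiffDiff.lowerOrder (A l 0)) :
    (¬ DiffDiff.MeroEq F 0 →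
      ∀ f : ℂ → ℂ, DiffDiff.IsMeroSolution A c F f →
        DiffDiff.lowerOrder (A l 0) ≤ DiffDiff.order f) ∧
    (DiffDiff.MeroEq F 0 →
      ∀ f : ℂ → ℂ, DiffDiff.IsMeroSolution A c 0 f → ¬ DiffDiff.MeroEq f 0 →
        DiffDiff.lowerOrder (A l 0) + 1 ≤ DiffDiff.order f) := by
  -- If the two index pairs coincided, `h2` would assert that a lower type is strictly smaller than
  -- itself.
  have hne : (k, p) ≠ (l, 0) := by
    rintro h
    obtain ⟨rfl, rfl⟩ := Prod.mk.inj h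
    exact (h2 rfl).false
  have hdom : DiffDiff.IsDominant A F l k p := fun _ _ hs hE =>
    DiffDiff.not_eventually_T_le h1 h1' h2 (fun h => (h3 h).1) (fun h h' => (h4 h h').1) hs hE
  exact ⟨fun hF0 f hsol =>
      DiffDiff.lowerOrder_le_order_of_isDominant hA hF hne hdom h1' h5 hF0 hsol,
    fun hF0 f hsol hf0 =>
      DiffDiff.lowerOrder_add_one_le_order_of_isDominant hA hF hne hdom h1' h5 hF0 hsol hf0⟩
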